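/- Let $(X,d)$ be a compact metric space with a finite Borel measure $\mu$, write $|B|=\mu(B)$, and let $B(x,r)$ denote open balls. Assume that $\mu$ is doubling: there is $D>0$ with $0<|B(x,2r)|\le 2^{D}|B(x,r)|$ for all $x\in X$, $r>0$. Let $L$ be a densely defined non-negative self-adjoint operator on the real Hilbert space $L_2(X,\mu)$ and put $D^\infty(L)=\bigcap_{k}D(L^k)$. Assume: (B) $D^\infty(L)$ is a (not necessarily unital) subalgebra of $C(X)$; so $\Gamma(f,g)=\tfrac12\bigl(fLg+gLf-L(fg)\bigr)\in L_1(X,\mu)$ is defined for $f,g\in D^\infty(L)$; (C) there is $c>0$ with $\int_X\Gamma(f,f)\,d\mu\le c\,\|L^{1/2}f\|^2$ for all $f\in D^\infty(L)$, where $L^{1/2}$ is the positive square root of $L$; (D) there are $C>0$ and $\rho_0>0$ such that for all $f\in D^\infty(L)$, $x\in X$ and $0<\rho<\rho_0$, with $B=B(x,\rho)$ and $f_B=\frac1{|B|}\int_B f\,d\mu$, $$\int_{B}|f-f_B|^2\,d\mu\le C\rho^2\int_{B}\Gamma(f,f)\,d\mu .$$ For $\omega>0$ let $E_\omega(L)$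 be the Paley–Wiener space of vectors whose spectral transform with respect to $L$ is supported in $[0,\omega]$, i.e. the range of the spectral projection of $L$ for $[0,\omega]$. For $\rho>0$ and $N\in\mathbb N$, a metric $(\rho,N)$-lattice is a set $\mathcal X_\rho\subset X$ such that the balls $B(p,\rho/2)$, $p\in\mathcal X_\rho$, are disjoint and the balls $B(p,\rho)$, $p\in\mathcal X_\rho$, cover $X$ with multiplicity at most $N$. Then: 1. Every space $E_\omega(L)$, $\omega>0$, is finite-dimensional. 2. $L$ has a discrete spectrum $0\le\lambda_0\le\lambda_1\le\dots$ (a finite list if $L_2(X,\mu)$ is finite-dimensional; otherwise $\lambda_j\to\infty$), without accumulation points, and there is an orthonormal basis $\{\psi_j\}$ of $L_2(X,\mu)$ with $\psi_j\in D(L)$ and $L\psi_j=\lambda_j\psi_j$. 3. There is $N\in\mathbb N$ such that $(\rho,N)$-lattices exist for all sufficiently small $\rho>0$; and for every $N\in\mathbb N$ there is $\gamma\in(0,1)$ such that for all sufficiently large $\omega$ $$\mathcal N_\omega\le\inf\operatorname{card}\bigl(\mathcal X_{\gamma\omega^{-1/2}}\bigr),$$ where $\mathcal N_\omega$ is the number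 of eigenvalues of $L$ not greater than $\omega$, counted with multiplicity, and the infimum is over all $(\gamma\omega^{-1/2},N)$-lattices ($\inf\emptyset=\infty$). -/

import Mathlib

open MeasureTheory Filter Topology Metric
open scoped ENNReal

noncomputable section

/-! ### Unbounded operators on a real Hilbert space -/

section Operators

variable {H : Type*} [NormedAddCommGroup H] [InnerProductSpace ℝ H]

/-- `L` is a non-negative self-adjoint operator: it is densely defined, equal to its adjoint, and
`⟪L f, f⟫ ≥ 0` on its domain. -/
structure IsNonnegSelfAdjoint [CompleteSpace H] (L : H →ₗ.[ℝ] H) : Prop where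
  dense : Dense (L.domain : Set H)
  selfAdjoint : IsSelfAdjoint L
  nonneg : ∀ f : L.domain, 0 ≤ inner ℝ (L f) (f : H)

/-- The value `L f` for `f` in the domain of `L` (and `0` elsewhere; it is only used on the
domain). -/
def opApply (L : H →ₗ.[ℝ] H) (f : H) : H :=
  open Classical in if h : f ∈ L.domain then L ⟨f, h⟩ else 0

/-- The domain of the power `L ^ k`: everything for `k = 0`, and
`D(L ^ (k + 1)) = {f ∈ D(L) | L f ∈ D(L ^ k)}`. -/
def powDomain (L : H →ₗ.[ℝ] H) : ℕ → Submodule ℝ H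
  | 0 => ⊤
  | k + 1 => ((powDomain L k).comap L.toFun).map L.domain.subtype

/-- `D^∞(L)`, the intersection of the domains of all powers of `L`. -/
def smoothDomain (L : H →ₗ.[ℝ] H) : Submodule ℝ H := ⨅ k, powDomain L k

/-- `S` is a positive square root of `L`: it is non-negative and self-adjoint and `S ∘ S = L`,
including equality of the domains. -/
def IsPosSqrt [CompleteSpace H] (S L : H →ₗ.[ℝ] H) : Prop :=
  IsNonnegSelfAdjoint S ∧
    ∀ f g : H, (f, g) ∈ L.graph ↔ ∃ h : H, (f, h) ∈ S.graph ∧ (h, g) ∈ S.graph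

/-- The positive square root `L^{1/2}` (it exists and is unique for a non-negative self-adjoint
`L`). -/
def opSqrt [CompleteSpace H] (L : H →ₗ.[ℝ] H) : H →ₗ.[ℝ] H :=
  Classical.epsilon fun S => IsPosSqrt S L

/-- `E` is the spectral measure of `L`. The first three clauses and the existence of the scalar
measures `m f : B ↦ ⟪E B f, f⟫` say that `E` is a projection-valued measure on the Borel sets of
`ℝ`; the last two say that `L = ∫ t dE(t)`, with its maximal domain. -/
def IsSpectralMeasure [CompleteSpace H] (L : H →ₗ.[ℝ] H) (E : Set ℝ → H →L[ℝ] H) : Prop :=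
  (∀ B, MeasurableSet B → IsStarProjection (E B)) ∧
  E Set.univ = 1 ∧
  (∀ B C, MeasurableSet B → MeasurableSet C → E (B ∩ C) = E B * E C) ∧
  ∃ m : H → Measure ℝ,
    (∀ f B, MeasurableSet B → m f B = ENNReal.ofReal (inner ℝ (E B f) f)) ∧
    (∀ f, f ∈ L.domain ↔ ∫⁻ t, ENNReal.ofReal (t ^ 2) ∂(m f) < ∞) ∧
    ∀ f : L.domain, inner ℝ (L f) (f : H) = ∫ t, t ∂(m (f : H))

/-- The spectral measure of `L` (it exists and is unique for a self-adjoint `L`). -/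
def spectralMeasure [CompleteSpace H] (L : H →ₗ.[ℝ] H) : Set ℝ → H →L[ℝ] H :=
  Classical.epsilon fun E => IsSpectralMeasure L E

/-- The Paley–Wiener space `E_ω(L)`: the vectors whose spectral transform with respect to `L` is
supported in `[0, ω]`. -/
def paleyWiener [CompleteSpace H] (L : H →ₗ.[ℝ] H) (ω : ℝ) : Submodule ℝ H :=
  LinearMap.range (spectralMeasure L (Set.Icc 0 ω) : H →ₗ[ℝ] H)

/-- The spectrum of `L`: the `z` for which `L - z` does not have an everywhere defined bounded
inverse `R`. -/
def opSpectrum (L : H →ₗ.[ℝ] H) : Set ℝ :=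
  {z | ¬ ∃ R : H →L[ℝ] H, ∀ f g : H, (f, g) ∈ L.graph ↔ R (g - z • f) = f}

/-- The eigenspace `{f ∈ D(L) | L f = t f}`. -/
def opEigenspace (L : H →ₗ.[ℝ] H) (t : ℝ) : Submodule ℝ H :=
  L.graph.comap (LinearMap.prod LinearMap.id (t • LinearMap.id))

/-- The number of eigenvalues of `L` not greater than `ω`, counted with multiplicity: the sum of
`dim ker (L - t)` over all `t ≤ ω`. -/
def eigenvalueCount (L : H →ₗ.[ℝ] H) (ω : ℝ) : ℕ∞ :=
  ⨆ s : Finset (Set.Iic ω), ∑ t ∈ s, Cardinal.toENat (Module.rank ℝ (opEigenspace L t))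

end Operators

/-! ### Metric measure spaces -/

section Spaces

variable {X : Type*} [MetricSpace X]

/-- The doubling condition for open balls (which in particular have positive measure). -/
def IsDoublingMeasure [MeasurableSpace X] (μ : Measure X) : Prop :=
  ∃ D : ℝ, 0 < D ∧ ∀ (x : X) (r : ℝ), 0 < r →
    0 < μ (ball x (2 * r)) ∧ μ (ball x (2 * r)) ≤ ENNReal.ofReal (2 ^ D) * μ (ball x r)

/-- A metric `(ρ, N)`-lattice: the balls `B(p, ρ / 2)` are disjoint, and the balls `B(p, ρ)` are a
cover of multiplicity at most `N`. -/
structure IsMetricLattice (ρ : ℝ) (N : ℕ) (P : Set X) : Prop where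
  disjoint : P.PairwiseDisjoint fun p => ball p (ρ / 2)
  cover : ⋃ p ∈ P, ball p ρ = Set.univ
  multiplicity : ∀ x : X, {p ∈ P | x ∈ ball p ρ}.encard ≤ N

variable [CompactSpace X] [MeasurableSpace X] [BorelSpace X]
  (μ : Measure X) [IsFiniteMeasure μ]

/-- The class in `L₂(X, μ)` of a continuous function. -/
def toL2 (f : C(X, ℝ)) : Lp ℝ 2 μ := ContinuousMap.toLp (E := ℝ) 2 μ ℝ f

variable {μ} (L : Lp ℝ 2 μ →ₗ.[ℝ] Lp ℝ 2 μ)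

/-- `D^∞(L)` is a subalgebra of `C(X)` (which is not required to contain the constants). -/
def SmoothDomainIsSubalgebra : Prop :=
  ∃ A : NonUnitalSubalgebra ℝ C(X, ℝ), toL2 μ '' (A : Set C(X, ℝ)) = smoothDomain L

/-- The bilinear map `Γ(f, g) = (f L g + g L f - L (f g)) / 2`, for `f`, `g` in `D^∞(L)`. -/
def carreDuChamp (f g : C(X, ℝ)) (x : X) : ℝ :=
  (f x * opApply L (toL2 μ g) x + g x * opApply L (toL2 μ f) x - opApply L (toL2 μ (f * g)) x) / 2

/-- The gradient bound `∫ Γ(f, f) ≤ c ‖L^{1/2} f‖²` on `D^∞(L)`. -/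
def GradientBound : Prop :=
  ∃ c : ℝ, 0 < c ∧ ∀ f : C(X, ℝ), toL2 μ f ∈ smoothDomain L →
    ∫ x, carreDuChamp L f f x ∂μ ≤ c * ‖opApply (opSqrt L) (toL2 μ f)‖ ^ 2

/-- The local Poincaré inequality on balls of sufficiently small radius, for `f` in `D^∞(L)`. -/
def LocalPoincare : Prop :=
  ∃ C : ℝ, 0 < C ∧ ∃ ρ₀ : ℝ, 0 < ρ₀ ∧ ∀ f : C(X, ℝ), toL2 μ f ∈ smoothDomain L →
    ∀ (x : X) (ρ : ℝ), 0 < ρ → ρ < ρ₀ →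
      ∫ y in ball x ρ, |f y - ⨍ z in ball x ρ, f z ∂μ| ^ 2 ∂μ ≤
        C * ρ ^ 2 * ∫ y in ball x ρ, carreDuChamp L f f y ∂μ

end Spaces

end

/-!
The argument reduces everything to one inequality. If the averages of `f` over the balls of a
`(ρ, N)`-lattice vanish, the local Poincaré inequalities, summed over the lattice, give
`‖f‖² ≤ C N ρ² ∫ Γ(f, f) ≤ K N ρ² ⟪L f, f⟫`; in general the averages enter as one linear functional
per lattice point. This is `exists_formBound_of_lattice`, with the estimate itself recorded by
`FormBound`. Summation with multiplicity `N` needs `Γ(f, f) ≥ 0` almost everywhere, which follows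
from the Poincaré inequality and Lebesgue differentiation (`IsDoublingMeasure.ae_nonneg`). The
hypotheses speak only of `D^∞(L)`; the inequality passes to all of `D(L)` because `D^∞(L)` is a core
(`IsResolvent.exists_smoothDomain_approx`).

A form bound with `ε = K N ρ²` and `n` lattice points shows that any space of vectors with
`⟪L f, f⟫ ≤ ω ‖f‖²`, where `ε ω < 1`, has dimension at most `n` (`FormBound.finrank_le`). Applied to
the range of a spectral projection and to sums of eigenspaces, with `ρ = γ ω ^ (-1/2)`, it gives the
finite dimension of `E_ω(L)` and the counting estimate. Form bounds with `ε → 0` also make the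
resolvent `R = (1 + L)⁻¹` compact (`IsResolvent.isCompactOperator`), and the spectral theorem for
compact operators then yields the eigenbasis and the discrete spectrum.

The square root and the spectral measure of `L` are specified by choice among the objects with the
right properties, so their existence has to be shown. The square root is needed before compactness
is known, hence for an arbitrary non-negative self-adjoint `L`: it is `P Q⁻¹` for square roots `Q`
of `R` and `P` of `1 - R`, which come from the Taylor series of `√(1 - x)`, whose coefficients are
Catalan numbers (`IsNonnegSelfAdjoint.exists_isPosSqrt`). The spectral measure is built from the
eigenbasis (`isSpectralMeasure_eigenProjection`). Lattices are maximal separated sets.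
-/

/-! ### Square roots of contractions -/

section CatalanSeries

/-- The Taylor coefficients of `1 - √(1 - x) = ∑ sqrtCoeff n * x ^ (n + 1)`. -/
noncomputable def sqrtCoeff (n : ℕ) : ℝ := catalan n / (2 * 4 ^ n)

lemma sqrtCoeff_nonneg (n : ℕ) : 0 ≤ sqrtCoeff n := by unfold sqrtCoeff; positivity

/-- The partial sums telescope, so the coefficients are summable with sum at most `1`. -/
lemma sum_range_sqrtCoeff (n : ℕ) :
    ∑ k ∈ Finset.range n, sqrtCoeff k = 1 - n.centralBinom / 4 ^ n := by
  induction n with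
  | zero => simp
  | succ n ih =>
    have h1 : ((n : ℝ) + 1) * catalan n = n.centralBinom := by
      exact_mod_cast succ_mul_catalan_eq_centralBinom n
    have h2 : ((n : ℝ) + 1) * (n + 1).centralBinom = 2 * (2 * n + 1) * n.centralBinom := by
      exact_mod_cast Nat.succ_mul_centralBinom_succ n
    have hn : (n : ℝ) + 1 ≠ 0 := by positivity
    have h3 : ((n + 1).centralBinom : ℝ) = 2 * (2 * n + 1) * catalan n := by
      apply mul_left_cancel₀ hn
      rw [h2, ← h1]; ring
    rw [Finset.sum_range_succ, ih, h3, ← h1, sqrtCoeff, pow_succ]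
    field_simp
    ring

lemma sum_range_sqrtCoeff_le (n : ℕ) : ∑ k ∈ Finset.range n, sqrtCoeff k ≤ 1 := by
  rw [sum_range_sqrtCoeff]
  have : (0 : ℝ) ≤ n.centralBinom / 4 ^ n := by positivity
  linarith

lemma summable_sqrtCoeff : Summable sqrtCoeff :=
  summable_of_sum_range_le sqrtCoeff_nonneg sum_range_sqrtCoeff_le

/-- Segner's recursion for the Catalan numbers. -/
lemma sum_antidiagonal_sqrtCoeff (n : ℕ) :
    ∑ p ∈ Finset.HasAntidiagonal.antidiagonal n, sqrtCoeff p.1 * sqrtCoeff p.2 =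
      2 * sqrtCoeff (n + 1) := by
  have h : (catalan (n + 1) : ℝ) =
      ∑ p ∈ Finset.HasAntidiagonal.antidiagonal n, (catalan p.1 : ℝ) * catalan p.2 := by
    rw [catalan_succ']; push_cast; rfl
  rw [sqrtCoeff, h, Finset.sum_div, Finset.mul_sum]
  refine Finset.sum_congr rfl fun p hp => ?_
  rw [← Finset.HasAntidiagonal.mem_antidiagonal.1 hp, sqrtCoeff, sqrtCoeff]
  field_simp
  ring

variable {𝔸 : Type*} [NormedRing 𝔸] [NormedAlgebra ℝ 𝔸]

lemma norm_sqrtCoeff_smul_pow_le {T : 𝔸} (hT : ‖T‖ ≤ 1) (n : ℕ) :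
    ‖sqrtCoeff n • T ^ (n + 1)‖ ≤ sqrtCoeff n := by
  rw [norm_smul, Real.norm_of_nonneg (sqrtCoeff_nonneg n)]
  exact mul_le_of_le_one_right (sqrtCoeff_nonneg n)
    ((norm_pow_le' T n.succ_pos).trans (pow_le_one₀ (norm_nonneg _) hT))

/-- In a Banach algebra `1 - T` has the square root `1 - A`, `A = ∑ sqrtCoeff n • T ^ (n + 1)`,
whenever `‖T‖ ≤ 1`: the series converges absolutely even on the boundary of the unit ball. -/
lemma exists_hasSum_sqrt_one_sub [CompleteSpace 𝔸] {T : 𝔸} (hT : ‖T‖ ≤ 1) :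
    ∃ A : 𝔸, HasSum (fun n => sqrtCoeff n • T ^ (n + 1)) A ∧ ‖A‖ ≤ 1 ∧
      (1 - A) * (1 - A) = 1 - T := by
  set a : ℕ → 𝔸 := fun n => sqrtCoeff n • T ^ (n + 1) with ha
  have hle : ∀ n, ‖a n‖ ≤ sqrtCoeff n := norm_sqrtCoeff_smul_pow_le hT
  have hn : Summable fun n => ‖a n‖ :=
    Summable.of_nonneg_of_le (fun _ => norm_nonneg _) hle summable_sqrtCoeff
  refine ⟨∑' n, a n, hn.of_norm.hasSum, ?_, ?_⟩
  · refine (norm_tsum_le_tsum_norm hn).trans ((hn.tsum_le_tsum hle summable_sqrtCoeff).trans ?_)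
    exact Real.tsum_le_of_sum_range_le sqrtCoeff_nonneg sum_range_sqrtCoeff_le
  · have hsq : (∑' n, a n) * (∑' n, a n) = ∑' n, (2 : ℝ) • a (n + 1) := by
      rw [tsum_mul_tsum_eq_tsum_sum_antidiagonal_of_summable_norm hn hn]
      refine tsum_congr fun n => ?_
      calc ∑ p ∈ Finset.HasAntidiagonal.antidiagonal n, a p.1 * a p.2
          = ∑ p ∈ Finset.HasAntidiagonal.antidiagonal n,
              (sqrtCoeff p.1 * sqrtCoeff p.2) • T ^ (n + 2) := by
            refine Finset.sum_congr rfl fun p hp => ?_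
            simp only [ha]
            rw [smul_mul_smul_comm, ← pow_add]
            congr 2
            have := Finset.HasAntidiagonal.mem_antidiagonal.1 hp
            omega
        _ = _ := by
            rw [← Finset.sum_smul, sum_antidiagonal_sqrtCoeff, mul_smul]
    have h0 : ∑' n, a n = (1 / 2 : ℝ) • T + ∑' n, a (n + 1) := by
      rw [hn.of_norm.tsum_eq_zero_add]
      simp [ha, sqrtCoeff]
    rw [tsum_const_smul'' (2 : ℝ)] at hsq
    have h2 : (2 : ℝ) • (∑' n, a n) = T + (2 : ℝ) • ∑' n, a (n + 1) := by
      rw [h0, smul_add, smul_smul]; norm_num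
    have h3 : (1 - ∑' n, a n) * (1 - ∑' n, a n)
        = 1 - (2 : ℝ) • (∑' n, a n) + (∑' n, a n) * (∑' n, a n) := by
      rw [two_smul]; noncomm_ring
    rw [h3, hsq, h2]; abel

end CatalanSeries

section Hilbert

variable {H : Type*} [NormedAddCommGroup H] [InnerProductSpace ℝ H]

/-- A positive square root of `1 - T`, for a self-adjoint contraction `T`; it is again of the form
`1 - A` with a self-adjoint contraction `A`, so that square roots can be iterated. -/
lemma exists_sqrt_one_sub [CompleteSpace H] {T : H →L[ℝ] H} (hT : ‖T‖ ≤ 1) (hs : IsSelfAdjoint T) :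
    ∃ A : H →L[ℝ] H, ‖A‖ ≤ 1 ∧ IsSelfAdjoint A ∧ (1 - A) * (1 - A) = 1 - T ∧
      ∀ B, Commute B T → Commute B A := by
  obtain ⟨A, hA, hA1, hA2⟩ := exists_hasSum_sqrt_one_sub hT
  refine ⟨A, hA1, ?_, hA2, fun B hB => ?_⟩
  · have := hA.star
    refine this.unique ?_
    convert hA using 2 with n
    rw [star_smul, star_pow, hs.star_eq]; simp
  · refine (hA.mul_left B).unique ?_
    convert hA.mul_right B using 2 with n
    rw [mul_smul_comm, smul_mul_assoc, (hB.pow_right (n + 1)).eq]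

lemma inner_one_sub_apply_nonneg {A : H →L[ℝ] H} (hA : ‖A‖ ≤ 1) (u : H) :
    0 ≤ inner ℝ ((1 - A) u) u := by
  have h1 : inner ℝ (A u) u ≤ ‖u‖ * ‖u‖ :=
    (real_inner_le_norm _ _).trans <| by
      gcongr
      exact (A.le_opNorm u).trans (mul_le_of_le_one_left (norm_nonneg _) hA)
  simp only [sub_apply, one_apply_eq_self, inner_sub_left,
    real_inner_self_eq_norm_mul_norm]
  linarith

end Hilbert

/-! ### The resolvent of a non-negative self-adjoint operator -/

section Resolvent

variable {H : Type*} [NormedAddCommGroup H] [InnerProductSpace ℝ H]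

/-- `R` is the resolvent `(1 + L)⁻¹`, as an everywhere defined bounded operator. -/
def IsResolvent (L : H →ₗ.[ℝ] H) (R : H →L[ℝ] H) : Prop :=
  ∀ f g : H, (f, g) ∈ L.graph ↔ R (f + g) = f

variable {L : H →ₗ.[ℝ] H} {R : H →L[ℝ] H}

lemma opApply_eq_of_mem_graph {f g : H} (h : (f, g) ∈ L.graph) : opApply L f = g := by
  obtain ⟨y, rfl, rfl⟩ := L.mem_graph_iff.1 h
  simp [opApply]

lemma IsNonnegSelfAdjoint.inner_graph_nonneg [CompleteSpace H] (hL : IsNonnegSelfAdjoint L)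
    {f g : H} (h : (f, g) ∈ L.graph) : 0 ≤ inner ℝ g f := by
  obtain ⟨y, rfl, rfl⟩ := L.mem_graph_iff.1 h
  exact hL.nonneg y

lemma IsNonnegSelfAdjoint.inner_graph_comm [CompleteSpace H] (hL : IsNonnegSelfAdjoint L)
    {f g f' g' : H} (h : (f, g) ∈ L.graph) (h' : (f', g') ∈ L.graph) :
    inner ℝ g f' = inner ℝ f g' := by
  rw [← LinearPMap.isSelfAdjoint_def.1 hL.selfAdjoint,
    LinearPMap.adjoint_graph_eq_graph_adjoint hL.dense, Submodule.mem_adjoint_iff] at h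
  have := h _ _ h'
  simp only at this
  rw [real_inner_comm f' g, real_inner_comm g' f]
  linarith

lemma IsNonnegSelfAdjoint.norm_le_norm_add [CompleteSpace H] (hL : IsNonnegSelfAdjoint L)
    {f g : H} (h : (f, g) ∈ L.graph) : ‖f‖ ≤ ‖f + g‖ ∧ ‖g‖ ≤ ‖f + g‖ := by
  have h0 := hL.inner_graph_nonneg h
  rw [real_inner_comm] at h0
  have h1 := norm_add_sq_real f g
  constructor <;> apply le_of_sq_le_sq _ (norm_nonneg _) <;>
    nlinarith [sq_nonneg ‖f‖, sq_nonneg ‖g‖]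

/-- `1 + L` maps `D(L)` onto `H`: its range is closed since `‖(1 + L) f‖` dominates the graph norm,
and it is dense since a vector orthogonal to it would be an eigenvector of `L† = L` for `-1`. -/
lemma IsNonnegSelfAdjoint.exists_add_eq [CompleteSpace H] (hL : IsNonnegSelfAdjoint L) (h : H) :
    ∃ f g, (f, g) ∈ L.graph ∧ f + g = h := by
  let Φ : L.graph →L[ℝ] H :=
    (ContinuousLinearMap.fst ℝ H H + ContinuousLinearMap.snd ℝ H H).comp L.graph.subtypeL
  have hΦ : ∀ x : L.graph, Φ x = x.1.1 + x.1.2 := fun x => rfl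
  have hcl : IsClosed (L.graph : Set (H × H)) := hL.selfAdjoint.isClosed
  have : CompleteSpace L.graph := hcl.completeSpace_coe
  have hanti : AntilipschitzWith 1 Φ := by
    refine Φ.antilipschitz_of_bound fun x => ?_
    have := hL.norm_le_norm_add x.2
    rw [NNReal.coe_one, one_mul, hΦ]
    exact max_le this.1 this.2
  have hrange : IsClosed (LinearMap.range (Φ : L.graph →ₗ[ℝ] H) : Set H) :=
    hanti.isClosed_range Φ.uniformContinuous
  have : CompleteSpace (LinearMap.range (Φ : L.graph →ₗ[ℝ] H)) := hrange.completeSpace_coe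
  have htop : LinearMap.range (Φ : L.graph →ₗ[ℝ] H) = ⊤ := by
    rw [← Submodule.orthogonal_eq_bot_iff, Submodule.eq_bot_iff]
    intro v hv
    have hmem : (v, -v) ∈ L.graph := by
      rw [← LinearPMap.isSelfAdjoint_def.1 hL.selfAdjoint,
        LinearPMap.adjoint_graph_eq_graph_adjoint hL.dense, Submodule.mem_adjoint_iff]
      intro a b hab
      have := Submodule.mem_orthogonal _ _ |>.1 hv _ ⟨⟨(a, b), hab⟩, rfl⟩
      simp only [ContinuousLinearMap.coe_coe, hΦ, inner_add_left] at this
      simp only [inner_neg_right]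
      linarith
    have := hL.inner_graph_nonneg hmem
    rw [inner_neg_left, real_inner_self_eq_norm_sq] at this
    have h2 : ‖v‖ ^ 2 = 0 := le_antisymm (by linarith) (sq_nonneg _)
    simpa using h2
  obtain ⟨x, hx⟩ := (LinearMap.range_eq_top.1 htop) h
  exact ⟨x.1.1, x.1.2, x.2, hx⟩

lemma IsNonnegSelfAdjoint.exists_isResolvent [CompleteSpace H] (hL : IsNonnegSelfAdjoint L) :
    ∃ R, IsResolvent L R := by
  choose F G hFG hadd using hL.exists_add_eq
  have key : ∀ f g, (f, g) ∈ L.graph → F (f + g) = f := by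
    intro f g hfg
    have h1 := L.graph.sub_mem (hFG (f + g)) hfg
    have h2 := (hL.norm_le_norm_add h1).1
    have h3 : F (f + g) - f + (G (f + g) - g) = 0 := by
      have := hadd (f + g)
      rw [← sub_eq_zero] at this
      rw [← this]; abel
    rw [h3, norm_zero] at h2
    exact sub_eq_zero.1 (norm_le_zero_iff.1 h2)
  let R₀ : H →ₗ[ℝ] H :=
    { toFun := F
      map_add' := fun x y => by
        have := key _ _ (L.graph.add_mem (hFG x) (hFG y))
        rwa [add_add_add_comm, hadd, hadd] at this
      map_smul' := fun c x => by
        have := key _ _ (L.graph.smul_mem c (hFG x))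
        rwa [← smul_add, hadd] at this }
  refine ⟨R₀.mkContinuous 1 fun x => ?_, fun f g => ⟨key f g, fun h => ?_⟩⟩
  · have := (hL.norm_le_norm_add (hFG x)).1
    rw [hadd] at this
    simpa [R₀] using this
  · have hF : F (f + g) = f := h
    have h1 := hFG (f + g)
    have h2 := hadd (f + g)
    rw [hF] at h1 h2
    rwa [add_left_cancel h2] at h1

namespace IsResolvent

lemma mem_graph (hR : IsResolvent L R) (h : H) : (R h, h - R h) ∈ L.graph := by
  rw [hR]; congr 1; abel

lemma norm_apply_le [CompleteSpace H] (hR : IsResolvent L R) (hL : IsNonnegSelfAdjoint L) (h : H) :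
    ‖R h‖ ≤ ‖h‖ := by
  simpa using (hL.norm_le_norm_add (hR.mem_graph h)).1

lemma norm_le_one [CompleteSpace H] (hR : IsResolvent L R) (hL : IsNonnegSelfAdjoint L) :
    ‖R‖ ≤ 1 :=
  R.opNorm_le_bound zero_le_one fun h => by simpa using hR.norm_apply_le hL h

lemma norm_one_sub_le_one [CompleteSpace H] (hR : IsResolvent L R) (hL : IsNonnegSelfAdjoint L) :
    ‖1 - R‖ ≤ 1 :=
  (1 - R).opNorm_le_bound zero_le_one fun h => by
    simpa using (hL.norm_le_norm_add (hR.mem_graph h)).2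

lemma isSymmetric [CompleteSpace H] (hR : IsResolvent L R) (hL : IsNonnegSelfAdjoint L) :
    (R : H →ₗ[ℝ] H).IsSymmetric := by
  intro x y
  have := hL.inner_graph_comm (hR.mem_graph x) (hR.mem_graph y)
  rw [inner_sub_left, inner_sub_right] at this
  simp only [ContinuousLinearMap.coe_coe]
  linarith

lemma isSelfAdjoint [CompleteSpace H] (hR : IsResolvent L R) (hL : IsNonnegSelfAdjoint L) :
    IsSelfAdjoint R :=
  ContinuousLinearMap.isSelfAdjoint_iff_isSymmetric.2 (hR.isSymmetric hL)

lemma eq_zero (hR : IsResolvent L R) {h : H} (h0 : R h = 0) : h = 0 := by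
  have := hR.mem_graph h
  rw [h0, sub_zero] at this
  exact L.graph_fst_eq_zero_snd this rfl

lemma mem_domain_iff (hR : IsResolvent L R) {f : H} : f ∈ L.domain ↔ ∃ h, R h = f := by
  constructor
  · intro hf
    exact ⟨_, (hR _ _).1 (L.mem_graph ⟨f, hf⟩)⟩
  · rintro ⟨h, rfl⟩
    exact LinearPMap.mem_domain_of_mem_graph (hR.mem_graph h)

lemma denseRange [CompleteSpace H] (hR : IsResolvent L R) (hL : IsNonnegSelfAdjoint L) :
    DenseRange R := by
  have : Set.range R = L.domain := by
    ext f; exact hR.mem_domain_iff.symm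
  rw [DenseRange, this]
  exact hL.dense

lemma pow_apply_mem_powDomain (hR : IsResolvent L R) (k : ℕ) (h : H) :
    (R ^ k) h ∈ powDomain L k := by
  induction k generalizing h with
  | zero => trivial
  | succ k ih =>
    obtain ⟨y, hy, hy'⟩ := L.mem_graph_iff.1 (hR.mem_graph ((R ^ k) h))
    refine ⟨y, ?_, ?_⟩
    · change L y ∈ powDomain L k
      rw [hy']
      have : (R ^ k) h - R ((R ^ k) h) = (R ^ k) (h - R h) := by
        rw [map_sub]
        congr 1
        change (R * R ^ k) h = (R ^ k * R) h
        rw [← pow_succ', pow_succ]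
      exact this ▸ ih _
    · rw [Submodule.subtype_apply, hy, pow_succ']; rfl

/-- The intersection of the ranges of the powers of the resolvent is dense. Given `h`, choose
`h₀ = h, h₁, h₂, …` with `R h_{n + 1}` very close to `h_n`; then `R ^ n h_n` converges to a vector
near `h` with preimages under all powers of `R`, namely the limits of `R ^ n h_{n + k}`. -/
lemma exists_norm_sub_le_of_mem_range_pow [CompleteSpace H] (hR : IsResolvent L R)
    (hL : IsNonnegSelfAdjoint L) (h : H) {ε : ℝ} (hε : 0 < ε) :
    ∃ g : H, (∀ k, ∃ u, (R ^ k) u = g) ∧ ‖h - g‖ ≤ ε := by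
  have hstep : ∀ (n : ℕ) (x : H), ∃ y, ‖x - R y‖ < ε / 2 / 2 ^ n := fun n x => by
    obtain ⟨_, ⟨y, rfl⟩, hy⟩ := Metric.mem_closure_iff.1 (hR.denseRange hL x) (ε / 2 / 2 ^ n)
      (by positivity)
    exact ⟨y, by rwa [← dist_eq_norm]⟩
  -- errors summable to `ε`, as `‖R ^ n‖ ≤ 1`
  choose next hnext using hstep
  let s : ℕ → H := fun n => Nat.rec h (fun n x => next n x) n
  have hs : ∀ n, ‖s n - R (s (n + 1))‖ ≤ ε / 2 / 2 ^ n := fun n => (hnext n (s n)).le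
  have hpow : ∀ n x, ‖(R ^ n) x‖ ≤ ‖x‖ := fun n x => by
    induction n with
    | zero => simp
    | succ n ih => rw [pow_succ']; exact (hR.norm_apply_le hL _).trans ih
  let v : ℕ → ℕ → H := fun k n => (R ^ n) (s (k + n))
  have hv : ∀ k n, dist (v k n) (v k (n + 1)) ≤ ε / 2 ^ k / 2 / 2 ^ n := fun k n => by
    have h1 : v k n - v k (n + 1) = (R ^ n) (s (k + n) - R (s (k + n + 1))) := by
      rw [map_sub]
      simp only [v, pow_succ]
      rfl
    rw [dist_eq_norm, h1]
    refine (hpow _ _).trans ((hs _).trans (le_of_eq ?_))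
    rw [pow_add]; field_simp
  choose g hg using fun k => cauchySeq_tendsto_of_complete (cauchySeq_of_le_geometric_two (hv k))
  have hRg : ∀ k, R (g (k + 1)) = g k := fun k => by
    have h1 : Tendsto (fun n => R (v (k + 1) n)) atTop (𝓝 (R (g (k + 1)))) :=
      (R.continuous.tendsto _).comp (hg (k + 1))
    have h2 : (fun n => R (v (k + 1) n)) = fun n => v k (n + 1) := by
      funext n
      simp only [v, pow_succ', add_assoc, add_comm 1 n]
      rfl
    rw [h2] at h1
    exact tendsto_nhds_unique h1 ((hg k).comp (tendsto_add_atTop_nat 1))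
  refine ⟨g 0, fun k => ⟨g k, ?_⟩, ?_⟩
  · induction k with
    | zero => simp
    | succ k ih => rw [pow_succ, ← ih, ← hRg k]; rfl
  · have := dist_le_of_le_geometric_two_of_tendsto₀ (hv 0) (hg 0)
    simpa [v, s, dist_eq_norm] using this

/-- `D^∞(L)` is a core for `L`: it is dense in `D(L)` for the graph norm. -/
lemma exists_smoothDomain_approx [CompleteSpace H] (hR : IsResolvent L R)
    (hL : IsNonnegSelfAdjoint L) {f g : H} (hfg : (f, g) ∈ L.graph) {ε : ℝ} (hε : 0 < ε) :
    ∃ f' g', f' ∈ smoothDomain L ∧ (f', g') ∈ L.graph ∧ ‖f - f'‖ ≤ ε ∧ ‖g - g'‖ ≤ ε := by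
  obtain ⟨w, hw, hle⟩ := hR.exists_norm_sub_le_of_mem_range_pow hL (f + g) hε
  have h1 := hL.norm_le_norm_add (L.graph.sub_mem hfg (hR.mem_graph w))
  have h2 : (f - R w) + (g - (w - R w)) = f + g - w := by abel
  simp only at h1
  rw [h2] at h1
  refine ⟨R w, w - R w, ?_, hR.mem_graph w, h1.1.trans hle, h1.2.trans hle⟩
  rw [smoothDomain, Submodule.mem_iInf]
  intro k
  obtain ⟨u, rfl⟩ := hw k
  have : R ((R ^ k) u) = (R ^ k) (R u) := by
    change (R * R ^ k) u = (R ^ k * R) u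
    rw [← pow_succ', pow_succ]
  rw [this]
  exact hR.pow_apply_mem_powDomain k _

end IsResolvent

end Resolvent

/-! ### The positive square root -/

section SquareRoot

variable {H : Type*} [NormedAddCommGroup H] [InnerProductSpace ℝ H] [CompleteSpace H]
  {L : H →ₗ.[ℝ] H}

/-- A non-negative self-adjoint operator has a positive square root. With `R = (1 + L)⁻¹` and
commuting positive `P`, `Q` such that `Q ^ 2 = R` and `P ^ 2 = 1 - R`, it is `P Q⁻¹`, the operator
with graph `{(Q u, P u)}`. -/
lemma IsNonnegSelfAdjoint.exists_isPosSqrt (hL : IsNonnegSelfAdjoint L) : ∃ S, IsPosSqrt S L := by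
  obtain ⟨R, hR⟩ := hL.exists_isResolvent
  have hRs := hR.isSelfAdjoint hL
  obtain ⟨A, hA1, hAs, hA2, hAc⟩ := exists_sqrt_one_sub (hR.norm_one_sub_le_one hL)
    ((IsSelfAdjoint.one _).sub hRs)
  obtain ⟨B, hB1, hBs, hB2, hBc⟩ := exists_sqrt_one_sub (hR.norm_le_one hL) hRs
  -- a square root `1 - V` of `Q = 1 - A`, which shows that `P Q` is positive
  obtain ⟨V, hV1, hVs, hV2, hVc⟩ := exists_sqrt_one_sub hA1 hAs
  have hcRA : Commute R A := hAc _ ((Commute.one_right _).sub_right (Commute.refl _))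
  have hcAB : Commute A B := hBc _ hcRA.symm
  have hcBV : Commute B V := hVc _ hcAB.symm
  set Q := 1 - A with hQ
  set P := 1 - B with hP
  set U := 1 - V with hU
  have hQs : ∀ x y, inner ℝ (Q x) y = inner ℝ x (Q y) :=
    ContinuousLinearMap.isSelfAdjoint_iff_isSymmetric.1 ((IsSelfAdjoint.one _).sub hAs)
  have hPs : ∀ x y, inner ℝ (P x) y = inner ℝ x (P y) :=
    ContinuousLinearMap.isSelfAdjoint_iff_isSymmetric.1 ((IsSelfAdjoint.one _).sub hBs)
  have hUs : ∀ x y, inner ℝ (U x) y = inner ℝ x (U y) :=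
    ContinuousLinearMap.isSelfAdjoint_iff_isSymmetric.1 ((IsSelfAdjoint.one _).sub hVs)
  have hcPQ : Commute P Q :=
    ((Commute.one_left _).sub_left ((Commute.one_right _).sub_right hcAB.symm))
  have hcPU : Commute P U :=
    ((Commute.one_left _).sub_left ((Commute.one_right _).sub_right hcBV))
  have hPQ : ∀ x, P (Q x) = Q (P x) := fun x => congrArg (fun T : H →L[ℝ] H => T x) hcPQ.eq
  have hPU : ∀ x, P (U x) = U (P x) := fun x => congrArg (fun T : H →L[ℝ] H => T x) hcPU.eq
  have hQQ : ∀ x, Q (Q x) = R x := fun x => by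
    have := congrArg (fun T : H →L[ℝ] H => T x) hA2
    simpa using this
  have hPP : ∀ x, P (P x) = x - R x := fun x => by
    have := congrArg (fun T : H →L[ℝ] H => T x) hB2
    simpa using this
  have hUU : ∀ x, U (U x) = Q x := fun x => congrArg (fun T : H →L[ℝ] H => T x) hV2
  have hsum : ∀ x, Q (Q x) + P (P x) = x := fun x => by rw [hQQ, hPP]; abel
  -- the solutions of `P a = Q b` are the pairs `(Q u, P u)`
  have hker : ∀ a b, P a = Q b → ∃ u, a = Q u ∧ b = P u := fun a b hab => by
    refine ⟨Q a + P b, ?_, ?_⟩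
    · rw [map_add, ← hPQ, ← hab, hsum]
    · rw [map_add, hPQ, hab, hsum]
  let G : Submodule ℝ (H × H) := LinearMap.range (Q.prod P : H →ₗ[ℝ] H × H)
  have hG : ∀ a b, (a, b) ∈ G ↔ ∃ u, a = Q u ∧ b = P u := fun a b => by
    constructor
    · rintro ⟨u, hu⟩
      exact ⟨u, (congrArg Prod.fst hu).symm, (congrArg Prod.snd hu).symm⟩
    · rintro ⟨u, rfl, rfl⟩
      exact ⟨u, rfl⟩
  have hfun : ∀ x ∈ G, x.1 = 0 → x.2 = 0 := by
    rintro ⟨a, b⟩ hx (h0 : a = 0)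
    obtain ⟨u, hu, rfl⟩ := (hG a b).1 hx
    have : u = 0 := hR.eq_zero (by rw [← hQQ, ← hu, h0, map_zero])
    simp [this]
  have hgraph : G.toLinearPMap.graph = G := Submodule.toLinearPMap_graph_eq G hfun
  set S := G.toLinearPMap with hS
  have hdense : Dense (S.domain : Set H) := by
    refine (hR.denseRange hL).mono ?_
    rintro _ ⟨x, rfl⟩
    refine LinearPMap.mem_domain_of_mem_graph (y := P (Q x)) ?_
    rw [hgraph, hG]
    exact ⟨Q x, (hQQ x).symm, rfl⟩
  refine ⟨S, ⟨hdense, ?_, ?_⟩, ?_⟩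
  · rw [LinearPMap.isSelfAdjoint_def]
    apply LinearPMap.eq_of_eq_graph
    rw [LinearPMap.adjoint_graph_eq_graph_adjoint hdense, hgraph]
    ext ⟨a, b⟩
    rw [Submodule.mem_adjoint_iff, hG]
    constructor
    · intro h
      apply hker
      refine ext_inner_left ℝ fun u => ?_
      have := h _ _ ((hG _ _).2 ⟨u, rfl, rfl⟩)
      rw [← hPs, ← hQs]
      exact sub_eq_zero.1 this
    · rintro ⟨u, rfl, rfl⟩ a b hab
      obtain ⟨w, rfl, rfl⟩ := (hG _ _).1 hab
      rw [sub_eq_zero, hPs, hPQ, ← hQs]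
  · intro f
    have := S.mem_graph f
    rw [hgraph, hG] at this
    obtain ⟨u, h1, h2⟩ := this
    rw [h1, h2, ← hUU u, ← hUs, ← hPU]
    exact inner_one_sub_apply_nonneg hB1 _
  · intro f g
    rw [hgraph]
    constructor
    · intro h
      have h1 := (hR f g).1 h
      refine ⟨P (Q (f + g)), (hG _ _).2 ⟨Q (f + g), ?_, rfl⟩, (hG _ _).2 ⟨P (f + g), hPQ _, ?_⟩⟩
      · rw [hQQ, h1]
      · rw [hPP, h1]; abel
    · rintro ⟨h, hfh, hhg⟩
      obtain ⟨u, rfl, rfl⟩ := (hG _ _).1 hfh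
      obtain ⟨v, h3, rfl⟩ := (hG _ _).1 hhg
      obtain ⟨w, rfl, rfl⟩ := hker _ _ h3
      rw [hR, hsum, hQQ]

lemma IsNonnegSelfAdjoint.norm_opSqrt_sq (hL : IsNonnegSelfAdjoint L) {f g : H}
    (hfg : (f, g) ∈ L.graph) : ‖opApply (opSqrt L) f‖ ^ 2 = inner ℝ g f := by
  have hS : IsPosSqrt (opSqrt L) L := Classical.epsilon_spec hL.exists_isPosSqrt
  obtain ⟨h, h1, h2⟩ := (hS.2 f g).1 hfg
  rw [opApply_eq_of_mem_graph h1, real_inner_comm f g, ← hS.1.inner_graph_comm h1 h2,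
    real_inner_self_eq_norm_sq]

end SquareRoot

/-! ### Form bounds, compactness and dimension counts -/

section FormBound

variable {H : Type*} [NormedAddCommGroup H] [InnerProductSpace ℝ H] {L : H →ₗ.[ℝ] H}

/-- The quadratic form of `L` controls the norm up to `n` linear functionals and the factor `ε`:
`‖f‖² ≤ ∑ ⟪u i, f⟫² + ε ⟪L f, f⟫` on `D(L)` for some vectors `u 1, …, u n`. -/
def FormBound (L : H →ₗ.[ℝ] H) (ε : ℝ) (n : ℕ) : Prop :=
  ∃ u : Fin n → H, ∀ f g : H, (f, g) ∈ L.graph →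
    ‖f‖ ^ 2 ≤ ∑ i, inner ℝ (u i) f ^ 2 + ε * inner ℝ g f

lemma FormBound.mono [CompleteSpace H] (hL : IsNonnegSelfAdjoint L) {ε ε' : ℝ} {n : ℕ}
    (h : FormBound L ε n) (hε : ε ≤ ε') : FormBound L ε' n := by
  obtain ⟨u, hu⟩ := h
  refine ⟨u, fun f g hfg => (hu f g hfg).trans ?_⟩
  gcongr
  exact hL.inner_graph_nonneg hfg

/-- A space on which the quadratic form of `L` is at most `ω < ε⁻¹` times the square of the norm
has dimension at most `n`, since the `n` functionals separate its points. -/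
lemma FormBound.finrank_le {ε ω : ℝ} {n : ℕ} (h : FormBound L ε n) (hε : 0 ≤ ε) (hω : ε * ω < 1)
    {M : Type*} [AddCommGroup M] [Module ℝ M] (T : M →ₗ[ℝ] H) (hT : Function.Injective T)
    (hM : ∀ v, ∃ g, (T v, g) ∈ L.graph ∧ inner ℝ g (T v) ≤ ω * ‖T v‖ ^ 2) :
    Module.Finite ℝ M ∧ Module.finrank ℝ M ≤ n := by
  obtain ⟨u, hu⟩ := h
  let Ψ : M →ₗ[ℝ] Fin n → ℝ := LinearMap.pi fun i => (innerₛₗ ℝ (u i)).comp T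
  have hΨ : Function.Injective Ψ := by
    rw [injective_iff_map_eq_zero]
    intro v hv
    have h0 : ∀ i, inner ℝ (u i) (T v) = 0 := fun i => congrFun hv i
    obtain ⟨g, hg, hle⟩ := hM v
    have h1 := hu _ _ hg
    simp only [h0] at h1
    have h2 : ‖T v‖ ^ 2 ≤ ε * ω * ‖T v‖ ^ 2 := by
      have := mul_le_mul_of_nonneg_left hle hε
      simp at h1
      linarith
    have h3 : ‖T v‖ ^ 2 = 0 := by nlinarith [sq_nonneg ‖T v‖]
    have h4 : T v = 0 := by simpa using h3
    exact hT (h4.trans (map_zero T).symm)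
  have hfin : Module.Finite ℝ M := Module.Finite.of_injective Ψ hΨ
  refine ⟨hfin, ?_⟩
  simpa using LinearMap.finrank_le_finrank_of_injective hΨ

/-- If form bounds hold with arbitrarily small `ε`, the resolvent is compact. For `a`, `b` in the
unit ball, the form bound makes `R a` and `R b` close as soon as the functionals `u i` take nearly
the same values at them, so the image of the ball is totally bounded. -/
lemma IsResolvent.isCompactOperator [CompleteSpace H] {R : H →L[ℝ] H} (hR : IsResolvent L R)
    (hL : IsNonnegSelfAdjoint L) (hF : ∀ ε > 0, ∃ n, FormBound L ε n) : IsCompactOperator R := by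
  suffices h : TotallyBounded (R '' closedBall 0 1) from
    (isCompactOperator_iff_isCompact_closure_image_closedBall (R : H →ₗ[ℝ] H) zero_lt_one).2
      (h.closure.isCompact_of_isClosed isClosed_closure)
  refine Metric.totallyBounded_of_finite_discretization fun η hη => ?_
  obtain ⟨n, u, hu⟩ := hF (η ^ 2 / 16) (by positivity)
  let Φ : H →L[ℝ] EuclideanSpace ℝ (Fin n) :=
    ((EuclideanSpace.equiv (Fin n) ℝ).symm : (Fin n → ℝ) →L[ℝ] EuclideanSpace ℝ (Fin n)).comp
      (ContinuousLinearMap.pi fun i => innerSL ℝ (u i))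
  have hΦ : ∀ x, ‖Φ x‖ ^ 2 = ∑ i, inner ℝ (u i) x ^ 2 := fun x => by
    rw [EuclideanSpace.norm_sq_eq]
    simp [Φ]
  have htb : TotallyBounded (Φ '' (R '' closedBall 0 1)) :=
    (((isBounded_closedBall.image R).image Φ).isCompact_closure).totallyBounded.subset
      subset_closure
  obtain ⟨t, ht, hcov⟩ := Metric.totallyBounded_iff.1 htb (η / 4) (by positivity)
  have hcov' : ∀ y : (R '' closedBall 0 1 : Set H), ∃ z : t, dist (Φ y) z < η / 4 := fun y => by
    have := hcov (Set.mem_image_of_mem Φ y.2)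
    simpa using this
  choose F hFd using hcov'
  have : Fintype t := ht.fintype
  refine ⟨ULift t, inferInstance, fun y => ⟨F y⟩, fun x y hxy => ?_⟩
  have hFxy : F x = F y := congrArg ULift.down hxy
  have h1 : ‖Φ (x - y)‖ ≤ η / 2 := by
    rw [map_sub, ← dist_eq_norm]
    have := dist_triangle_right (Φ x) (Φ y) (F x)
    have hx := hFd x
    have hy := hFd y
    rw [← hFxy] at hy
    linarith
  obtain ⟨_, ⟨a, ha, rfl⟩⟩ := x
  obtain ⟨_, ⟨b, hb, rfl⟩⟩ := y
  rw [mem_closedBall_zero_iff] at ha hb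
  have hab : ‖a - b‖ ≤ 2 := (norm_sub_le _ _).trans (by linarith)
  have hgr := hR.mem_graph (a - b)
  have h2 := hL.norm_le_norm_add hgr
  rw [add_sub_cancel] at h2
  have h3 : inner ℝ (a - b - R (a - b)) (R (a - b)) ≤ 4 :=
    (real_inner_le_norm _ _).trans <| by
      nlinarith [norm_nonneg (R (a - b)), norm_nonneg (a - b - R (a - b))]
  have h4 := hu _ _ hgr
  rw [← hΦ, map_sub] at h4
  simp only at h1
  have h5 : ‖R a - R b‖ ^ 2 < η ^ 2 := by
    rw [map_sub] at h3
    nlinarith [norm_nonneg (Φ (R a - R b))]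
  rw [dist_eq_norm]
  exact lt_of_pow_lt_pow_left₀ 2 hη.le h5

lemma inner_sum_smul_sum_of_orthogonal {ι : Type*} [Fintype ι] {v : ι → H}
    (hv : Pairwise fun i j => inner ℝ (v i) (v j) = 0) (t : ι → ℝ) :
    inner ℝ (∑ i, t i • v i) (∑ i, v i) = ∑ i, t i * ‖v i‖ ^ 2 := by
  classical
  rw [sum_inner]
  refine Finset.sum_congr rfl fun i _ => ?_
  rw [inner_sum, Finset.sum_eq_single i (fun j _ hj => ?_) (by simp)]
  · rw [inner_smul_left, real_inner_self_eq_norm_sq]; rfl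
  · rw [inner_smul_left, hv hj.symm, mul_zero]

lemma inner_sum_smul_le {ι : Type*} [Fintype ι] {v : ι → H}
    (hv : Pairwise fun i j => inner ℝ (v i) (v j) = 0) {t : ι → ℝ} {ω : ℝ} (ht : ∀ i, t i ≤ ω) :
    inner ℝ (∑ i, t i • v i) (∑ i, v i) ≤ ω * ‖∑ i, v i‖ ^ 2 := by
  have h1 := inner_sum_smul_sum_of_orthogonal hv fun _ => (1 : ℝ)
  simp only [one_smul, one_mul, real_inner_self_eq_norm_sq] at h1
  rw [inner_sum_smul_sum_of_orthogonal hv, h1, Finset.mul_sum]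
  exact Finset.sum_le_sum fun i _ => by gcongr; exact ht i

lemma sum_mem_graph {ι : Type*} [Fintype ι] {v : ι → H} {t : ι → ℝ}
    (hv : ∀ i, (v i, t i • v i) ∈ L.graph) : (∑ i, v i, ∑ i, t i • v i) ∈ L.graph := by
  have := L.graph.sum_mem fun i (_ : i ∈ Finset.univ) => hv i
  rwa [← prod_mk_sum] at this

lemma IsNonnegSelfAdjoint.inner_eq_zero_of_ne [CompleteSpace H] (hL : IsNonnegSelfAdjoint L)
    {s t : ℝ} (hst : s ≠ t) {f g : H} (hf : (f, s • f) ∈ L.graph) (hg : (g, t • g) ∈ L.graph) :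
    inner ℝ f g = 0 := by
  have := hL.inner_graph_comm hf hg
  rw [inner_smul_left, inner_smul_right] at this
  simp only [conj_trivial] at this
  have h2 : (s - t) * inner ℝ f g = 0 := by rw [sub_mul, this, sub_self]
  exact (mul_eq_zero.1 h2).resolve_left (sub_ne_zero.2 hst)

lemma FormBound.eigenvalueCount_le [CompleteSpace H] (hL : IsNonnegSelfAdjoint L) {ε ω : ℝ} {n : ℕ}
    (h : FormBound L ε n) (hε : 0 ≤ ε) (hω : ε * ω < 1) : eigenvalueCount L ω ≤ n := by
  classical
  refine iSup_le fun s => ?_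
  have hfin : ∀ t : s, Module.Finite ℝ (opEigenspace L (t.1 : ℝ)) := fun t =>
    (h.finrank_le hε hω (opEigenspace L (t.1 : ℝ)).subtype (Submodule.injective_subtype _)
      fun v => ⟨(t.1 : ℝ) • (v : H), v.2, by
        rw [Submodule.subtype_apply, inner_smul_left, real_inner_self_eq_norm_sq]
        exact mul_le_mul_of_nonneg_right t.1.2 (sq_nonneg _)⟩).1
  let T : ((t : s) → opEigenspace L (t.1 : ℝ)) →ₗ[ℝ] H :=
    ∑ t : s, (opEigenspace L (t.1 : ℝ)).subtype.comp (LinearMap.proj t)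
  have hT : ∀ v, T v = ∑ t, (v t : H) := fun v => by simp [T]
  have horth : ∀ v : (t : s) → opEigenspace L (t.1 : ℝ),
      Pairwise fun i j => inner ℝ (v i : H) (v j : H) = 0 := fun v i j hij =>
    hL.inner_eq_zero_of_ne (fun h => hij (Subtype.ext (Subtype.ext h)))
      (v i).2 (v j).2
  have hinj : Function.Injective T := by
    rw [injective_iff_map_eq_zero]
    intro v hv
    have h1 := inner_sum_smul_sum_of_orthogonal (horth v) fun _ => (1 : ℝ)
    rw [← hT, hv, inner_zero_right] at h1
    have h2 := (Finset.sum_eq_zero_iff_of_nonneg fun i _ => by positivity).1 h1.symm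
    funext t
    simpa using h2 t (Finset.mem_univ _)
  have h2 := (h.finrank_le hε hω T hinj fun v =>
    ⟨∑ t : s, (t.1 : ℝ) • (v t : H), by
      rw [hT]; exact sum_mem_graph fun t => (v t).2, by
      rw [hT]; exact inner_sum_smul_le (horth v) fun t => t.1.2⟩).2
  rw [Module.finrank_pi_fintype] at h2
  calc ∑ t ∈ s, Cardinal.toENat (Module.rank ℝ (opEigenspace L (t : ℝ)))
      = ∑ t : s, Cardinal.toENat (Module.rank ℝ (opEigenspace L (t.1 : ℝ))) :=
        (Finset.sum_coe_sort s fun t : Set.Iic ω =>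
          Cardinal.toENat (Module.rank ℝ (opEigenspace L (t : ℝ)))).symm
    _ = ∑ t : s, (Module.finrank ℝ (opEigenspace L (t.1 : ℝ)) : ℕ∞) := by
        refine Finset.sum_congr rfl fun t _ => ?_
        have := hfin t
        rw [← Module.finrank_eq_rank, map_natCast]
    _ ≤ n := by exact_mod_cast h2

/-- Orthonormal eigenvectors with eigenvalues at most `ω < ε⁻¹` are at most `n` in number. -/
lemma FormBound.finite_setOf_eigenvalue_le {ε ω : ℝ} {n : ℕ}
    (h : FormBound L ε n) (hε : 0 ≤ ε) (hω : ε * ω < 1) {ι : Type*} {b : ι → H}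
    (hb : Orthonormal ℝ b) {lam : ι → ℝ} (hlam : ∀ i, (b i, lam i • b i) ∈ L.graph) :
    {i | lam i ≤ ω}.Finite := by
  by_contra hinf
  obtain ⟨F, hF, hcard⟩ := Set.Infinite.exists_subset_card_eq hinf (n + 1)
  have hbF : Orthonormal ℝ fun i : F => b i := hb.comp _ Subtype.val_injective
  have h2 := (h.finrank_le hε hω (Fintype.linearCombination ℝ fun i : F => b i)
    (linearIndependent_iff_injective_fintypeLinearCombination.1 hbF.linearIndependent) fun v =>
    ⟨∑ i : F, lam i • (v i • b i), by
      rw [Fintype.linearCombination_apply]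
      refine sum_mem_graph fun i => ?_
      rw [smul_comm]
      exact L.graph.smul_mem (v i) (hlam i), by
      rw [Fintype.linearCombination_apply]
      refine inner_sum_smul_le (fun i j hij => ?_) fun i => hF i.2
      change inner ℝ (v i • b i) (v j • b j) = 0
      rw [inner_smul_left, inner_smul_right, hbF.2 hij, mul_zero, mul_zero]⟩).2
  simp [hcard] at h2

end FormBound

/-! ### Eigenbases and the spectral measure -/

section Eigenbasis

variable {H : Type*} [NormedAddCommGroup H] [InnerProductSpace ℝ H] {L : H →ₗ.[ℝ] H}
  {ι : Type*} {b : HilbertBasis ι ℝ H} {lam : ι → ℝ}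

lemma IsResolvent.exists_eigenbasis [CompleteSpace H] {R : H →L[ℝ] H} (hR : IsResolvent L R)
    (hL : IsNonnegSelfAdjoint L) (hc : IsCompactOperator R) :
    ∃ (ι : Type) (b : HilbertBasis ι ℝ H) (lam : ι → ℝ), ∀ i, (b i, lam i • b i) ∈ L.graph := by
  let V : ℝ → Submodule ℝ H := fun t => Module.End.eigenspace (R : H →ₗ[ℝ] H) t
  have hV0 : V 0 = ⊥ := by
    rw [Submodule.eq_bot_iff]
    intro x hx
    have := Module.End.mem_eigenspace_iff.1 hx
    rw [zero_smul] at this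
    exact hR.eq_zero this
  have hfin : ∀ t, FiniteDimensional ℝ (V t) := fun t => by
    by_cases ht : t = 0
    · rw [ht, hV0]; infer_instance
    · exact ContinuousLinearMap.finite_dimensional_eigenspace hc t ht
  let c : ∀ t, OrthonormalBasis (Fin (Module.finrank ℝ (V t))) ℝ (V t) :=
    fun t => stdOrthonormalBasis ℝ (V t)
  have hon : Orthonormal ℝ fun a : Σ t, Fin (Module.finrank ℝ (V t)) => ((c a.1 a.2 : V a.1) : H) :=
    (hR.isSymmetric hL).orthogonalFamily_eigenspaces.orthonormal_sigma_orthonormal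
      fun t => (c t).orthonormal
  have hspan : (Submodule.span ℝ (Set.range fun a : Σ t, Fin (Module.finrank ℝ (V t)) =>
      ((c a.1 a.2 : V a.1) : H)))ᗮ = ⊥ := by
    rw [eq_bot_iff, ← ContinuousLinearMap.orthogonalComplement_iSup_eigenspaces_eq_bot hc
      (hR.isSymmetric hL)]
    refine Submodule.orthogonal_le (iSup_le fun t x hx => ?_)
    have h1 := (c t).sum_repr ⟨x, hx⟩
    have h2 : x = ∑ i, (c t).repr ⟨x, hx⟩ i • ((c t i : V t) : H) := by
      have := congrArg (Submodule.subtype (V t)) h1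
      simpa using this.symm
    rw [h2]
    exact Submodule.sum_mem _ fun i _ => Submodule.smul_mem _ _ <|
      Submodule.subset_span ⟨⟨t, i⟩, rfl⟩
  refine ⟨_, HilbertBasis.mkOfOrthogonalEqBot hon hspan, fun a => a.1⁻¹ - 1, fun a => ?_⟩
  rw [HilbertBasis.coe_mkOfOrthogonalEqBot, hR]
  have ha : R (c a.1 a.2 : V a.1) = a.1 • ((c a.1 a.2 : V a.1) : H) :=
    Module.End.mem_eigenspace_iff.1 (c a.1 a.2).2
  have hne : a.1 ≠ 0 := fun h0 => by
    have h1 : ((c a.1 a.2 : V a.1) : H) = 0 := hR.eq_zero <| by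
      rw [ha]
      exact smul_eq_zero_of_left h0 _
    exact hon.ne_zero a h1
  rw [sub_smul, one_smul, add_sub_cancel, map_smul, ha, smul_smul, inv_mul_cancel₀ hne, one_smul]

variable (hb : ∀ i, (b i, lam i • b i) ∈ L.graph)
include hb

lemma eigenvalue_nonneg [CompleteSpace H] (hL : IsNonnegSelfAdjoint L) (i : ι) : 0 ≤ lam i := by
  have := hL.inner_graph_nonneg (hb i)
  rwa [inner_smul_left, real_inner_self_eq_norm_sq, b.orthonormal.1 i, one_pow, mul_one] at this

lemma inner_eigenbasis_of_mem_graph [CompleteSpace H] (hL : IsNonnegSelfAdjoint L) {f g : H}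
    (hfg : (f, g) ∈ L.graph) (i : ι) : inner ℝ (b i) g = lam i * inner ℝ (b i) f := by
  rw [← hL.inner_graph_comm (hb i) hfg, inner_smul_left]; rfl

omit hb in
lemma HilbertBasis.ext_inner (b : HilbertBasis ι ℝ H) {f g : H}
    (h : ∀ i, inner ℝ (b i) f = inner ℝ (b i) g) : f = g := by
  apply b.repr.injective
  ext i
  rw [b.repr_apply_apply, b.repr_apply_apply, h]

lemma inner_eigenbasis_resolvent [CompleteSpace H] (hL : IsNonnegSelfAdjoint L) {R : H →L[ℝ] H}
    (hR : IsResolvent L R) (i : ι) (x : H) :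
    (1 + lam i) * inner ℝ (b i) (R x) = inner ℝ (b i) x := by
  have h := inner_eigenbasis_of_mem_graph hb hL (hR.mem_graph x) i
  rw [inner_sub_right] at h
  linarith

lemma mem_graph_iff_inner_eigenbasis [CompleteSpace H] (hL : IsNonnegSelfAdjoint L) {f g : H} :
    (f, g) ∈ L.graph ↔ ∀ i, inner ℝ (b i) g = lam i * inner ℝ (b i) f := by
  refine ⟨fun h => inner_eigenbasis_of_mem_graph hb hL h, fun h => ?_⟩
  obtain ⟨R, hR⟩ := hL.exists_isResolvent
  rw [hR]
  refine b.ext_inner fun i => ?_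
  have h1 := inner_eigenbasis_resolvent hb hL hR i (f + g)
  have h0 : 1 + lam i ≠ 0 := by have := eigenvalue_nonneg hb hL i; positivity
  apply mul_left_cancel₀ h0
  rw [h1, inner_add_right, h]
  ring

lemma mem_domain_iff_summable [CompleteSpace H] (hL : IsNonnegSelfAdjoint L) {f : H} :
    f ∈ L.domain ↔ Summable fun i => lam i ^ 2 * inner ℝ (b i) f ^ 2 := by
  constructor
  · intro hf
    have h1 := b.summable_inner_mul_inner (L ⟨f, hf⟩) (L ⟨f, hf⟩)
    refine h1.congr fun i => ?_
    have h2 := inner_eigenbasis_of_mem_graph hb hL (L.mem_graph ⟨f, hf⟩) i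
    rw [real_inner_comm, h2]
    ring
  · intro hs
    have hmem : Memℓp (fun i => lam i * inner ℝ (b i) f) 2 := by
      refine memℓp_gen ?_
      convert hs using 2 with i
      simp [mul_pow]
    refine LinearPMap.mem_domain_of_mem_graph
      (y := b.repr.symm (⟨fun i => lam i * inner ℝ (b i) f, hmem⟩ : lp (fun _ : ι => ℝ) 2)) ?_
    rw [mem_graph_iff_inner_eigenbasis hb hL]
    intro i
    rw [← b.repr_apply_apply, LinearIsometryEquiv.apply_symm_apply]

omit hb in
/-- The orthogonal projection onto the closed span of the basis vectors with `lam i ∈ B`. -/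
noncomputable def eigenProjection [CompleteSpace H] (b : HilbertBasis ι ℝ H) (lam : ι → ℝ)
    (B : Set ℝ) : H →L[ℝ] H :=
  (Submodule.span ℝ (b '' (lam ⁻¹' B))).topologicalClosure.starProjection

omit hb in
lemma inner_eigenProjection [CompleteSpace H] (B : Set ℝ) (i : ι) (f : H) :
    inner ℝ (b i) (eigenProjection b lam B f) = (lam ⁻¹' B).indicator 1 i * inner ℝ (b i) f := by
  rw [eigenProjection, ← Submodule.inner_starProjection_left_eq_right]
  by_cases hi : i ∈ lam ⁻¹' B
  · have hmem : b i ∈ (Submodule.span ℝ (b '' (lam ⁻¹' B))).topologicalClosure :=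
      Submodule.le_topologicalClosure _ (Submodule.subset_span ⟨i, hi, rfl⟩)
    rw [Submodule.starProjection_eq_self_iff.2 hmem, Set.indicator_of_mem hi]
    simp
  · rw [(Submodule.starProjection_apply_eq_zero_iff _).2, Set.indicator_of_notMem hi,
      inner_zero_left, zero_mul]
    rw [Submodule.orthogonal_closure]
    refine (Submodule.mem_orthogonal _ _).2 fun x hx => ?_
    induction hx using Submodule.span_induction with
    | mem x hx =>
      obtain ⟨j, hj, rfl⟩ := hx
      exact b.orthonormal.2 fun h => hi (h ▸ hj)
    | zero => simp
    | add x y _ _ hx hy => rw [inner_add_left, hx, hy, add_zero]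
    | smul c x _ hx => rw [inner_smul_left, hx, mul_zero]

omit hb in
lemma hasSum_inner_eigenProjection [CompleteSpace H] (B : Set ℝ) (f : H) :
    HasSum (fun i => (lam ⁻¹' B).indicator 1 i * inner ℝ (b i) f ^ 2)
      (inner ℝ (eigenProjection b lam B f) f) := by
  have := b.hasSum_inner_mul_inner (eigenProjection b lam B f) f
  have hterm : (fun i => (lam ⁻¹' B).indicator 1 i * inner ℝ (b i) f ^ 2) =
      fun i => inner ℝ (eigenProjection b lam B f) (b i) * inner ℝ (b i) f := by
    funext i
    rw [real_inner_comm (b i), inner_eigenProjection]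
    ring
  rwa [hterm]

/-- The scalar spectral measure `∑ i, ⟪b i, f⟫² δ_(lam i)` of a vector `f`. -/
noncomputable def eigenMeasure (b : HilbertBasis ι ℝ H) (lam : ι → ℝ) (f : H) : Measure ℝ :=
  Measure.sum fun i => ENNReal.ofReal (inner ℝ (b i) f ^ 2) • Measure.dirac (lam i)

omit hb in
lemma lintegral_eigenMeasure (f : H) (φ : ℝ → ℝ) (hφ : ∀ i, 0 ≤ φ (lam i)) :
    ∫⁻ t, ENNReal.ofReal (φ t) ∂(eigenMeasure b lam f) =
      ∑' i, ENNReal.ofReal (φ (lam i) * inner ℝ (b i) f ^ 2) := by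
  rw [eigenMeasure, lintegral_sum_measure]
  refine tsum_congr fun i => ?_
  rw [lintegral_smul_measure, lintegral_dirac, smul_eq_mul, mul_comm,
    ENNReal.ofReal_mul (hφ i)]

lemma isSpectralMeasure_eigenProjection [CompleteSpace H] (hL : IsNonnegSelfAdjoint L) :
    IsSpectralMeasure L (eigenProjection b lam) := by
  refine ⟨fun B _ => isStarProjection_starProjection, ?_, fun B C _ _ => ?_,
    eigenMeasure b lam, fun f B hB => ?_, fun f => ?_, fun f => ?_⟩
  · ext f
    refine b.ext_inner fun i => ?_
    rw [inner_eigenProjection]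
    simp
  · ext f
    refine b.ext_inner fun i => ?_
    rw [mul_apply_eq_comp, inner_eigenProjection, inner_eigenProjection,
      inner_eigenProjection, Set.preimage_inter, Set.inter_indicator_one, Pi.mul_apply, mul_assoc]
  · have h := hasSum_inner_eigenProjection (b := b) (lam := lam) B f
    rw [← h.tsum_eq, ENNReal.ofReal_tsum_of_nonneg
      (fun i => mul_nonneg (Set.indicator_nonneg (by simp) i) (sq_nonneg _)) h.summable,
      eigenMeasure, Measure.sum_apply _ hB]
    refine tsum_congr fun i => ?_
    by_cases hi : lam i ∈ B <;> simp [hi, hB]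
  · rw [mem_domain_iff_summable hb hL, lintegral_eigenMeasure f (fun t => t ^ 2)
      fun i => sq_nonneg _]
    refine ⟨fun h => h.tsum_ofReal_lt_top, fun h => ?_⟩
    have := ENNReal.summable_toReal h.ne
    refine this.congr fun i => ENNReal.toReal_ofReal (by positivity)
  · have h0 : 0 ≤ᵐ[eigenMeasure b lam (f : H)] fun t : ℝ => t := by
      rw [EventuallyLE, ae_iff]
      have hset : {t : ℝ | ¬ (0 : ℝ → ℝ) t ≤ t} = Set.Iio 0 := by ext t; simp
      rw [hset]
      rw [eigenMeasure, Measure.sum_apply _ (measurableSet_Iio (a := (0 : ℝ))), ENNReal.tsum_eq_zero]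
      intro i
      simp [(eigenvalue_nonneg hb hL i).not_gt]
    rw [integral_eq_lintegral_of_nonneg_ae h0 measurable_id.aestronglyMeasurable,
      lintegral_eigenMeasure _ (fun t => t) (eigenvalue_nonneg hb hL)]
    have hs : HasSum (fun i => lam i * inner ℝ (b i) (f : H) ^ 2) (inner ℝ (L f) (f : H)) := by
      have hterm : (fun i => lam i * inner ℝ (b i) (f : H) ^ 2) =
          fun i => inner ℝ (L f) (b i) * inner ℝ (b i) (f : H) := by
        funext i
        rw [real_inner_comm (b i), inner_eigenbasis_of_mem_graph hb hL (L.mem_graph f) i]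
        ring
      rw [hterm]
      exact b.hasSum_inner_mul_inner (L f) f
    have hnn : ∀ i, 0 ≤ lam i * inner ℝ (b i) (f : H) ^ 2 := fun i =>
      mul_nonneg (eigenvalue_nonneg hb hL i) (sq_nonneg _)
    rw [← ENNReal.ofReal_tsum_of_nonneg hnn hs.summable, hs.tsum_eq,
      ENNReal.toReal_ofReal (hs.nonneg hnn)]

/-- The spectrum consists of the eigenvalues, by the Fredholm alternative for the compact
resolvent. -/
lemma opSpectrum_eq_range [CompleteSpace H] (hL : IsNonnegSelfAdjoint L) {R : H →L[ℝ] H}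
    (hR : IsResolvent L R) (hc : IsCompactOperator R) : opSpectrum L = Set.range lam := by
  ext z
  constructor
  · intro hz
    by_contra hne
    have hunit : IsUnit (1 - (1 + z) • R) := by
      by_cases h1 : 1 + z = 0
      · rw [h1, zero_smul, sub_zero]; exact isUnit_one
      have hns : (1 + z)⁻¹ ∉ spectrum ℝ R := fun hmem => by
        obtain ⟨v, hv⟩ := ((hc.hasEigenvalue_iff_mem_spectrum (inv_ne_zero h1)).2
          hmem).exists_hasEigenvector
        refine hv.2 (b.ext_inner fun i => ?_)
        have h2 : R v = (1 + z)⁻¹ • v := hv.apply_eq_smul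
        have h3 := inner_eigenbasis_resolvent hb hL hR i v
        rw [h2, inner_smul_right] at h3
        have h4 : (lam i - z) * inner ℝ (b i) v = 0 := by
          field_simp at h3
          linarith
        rw [inner_zero_right]
        exact (mul_eq_zero.1 h4).resolve_left (sub_ne_zero.2 fun h => hne ⟨i, h⟩)
      rw [spectrum.notMem_iff] at hns
      have h5 := (Units.mk0 (1 + z) h1).isUnit.map (algebraMap ℝ (H →L[ℝ] H)) |>.mul hns
      convert h5 using 1
      rw [Units.val_mk0, ← Algebra.smul_def, smul_sub, Algebra.algebraMap_eq_smul_one, smul_smul,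
        mul_inv_cancel₀ h1, one_smul]
    obtain ⟨W, hW⟩ := hunit
    refine hz ⟨(↑W⁻¹ : H →L[ℝ] H) * R, fun f g => ?_⟩
    have hWi : ∀ x y : H, (W : H →L[ℝ] H) x = y ↔ (↑W⁻¹ : H →L[ℝ] H) y = x := fun x y => by
      have h1 : ∀ x, (W : H →L[ℝ] H) ((↑W⁻¹ : H →L[ℝ] H) x) = x := fun x =>
        congrArg (fun T : H →L[ℝ] H => T x) W.mul_inv
      have h2 : ∀ x, (↑W⁻¹ : H →L[ℝ] H) ((W : H →L[ℝ] H) x) = x := fun x =>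
        congrArg (fun T : H →L[ℝ] H => T x) W.inv_mul
      exact ⟨fun h => by rw [← h, h2], fun h => by rw [← h, h1]⟩
    rw [mul_apply_eq_comp, ← hWi, hW, hR]
    have h6 : (1 - (1 + z) • R) f = f - (1 + z) • R f := rfl
    rw [h6, map_add, map_sub, map_smul, add_smul, one_smul]
    constructor <;> intro h
    · nth_rewrite 1 [← h]; abel
    · rw [sub_eq_sub_iff_add_eq_add] at h
      have : R f + R g + z • R f = f + z • R f := by rw [h]; abel
      exact add_right_cancel this
  · rintro ⟨i, rfl⟩ ⟨T, hT⟩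
    have h1 := (hT _ _).1 (hb i)
    rw [sub_self, map_zero] at h1
    exact b.orthonormal.ne_zero i h1.symm

end Eigenbasis

/-! ### Paley–Wiener spaces -/

section PaleyWiener

variable {H : Type*} [NormedAddCommGroup H] [InnerProductSpace ℝ H] [CompleteSpace H]
  {L : H →ₗ.[ℝ] H}

/-- On the range of `E [0, ω]` the quadratic form of `L` is at most `ω ‖·‖²`. -/
lemma IsSpectralMeasure.exists_inner_le {E : Set ℝ → H →L[ℝ] H} (hE : IsSpectralMeasure L E)
    (ω : ℝ) (f : H) :
    ∃ g, (E (Set.Icc 0 ω) f, g) ∈ L.graph ∧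
      inner ℝ g (E (Set.Icc 0 ω) f) ≤ ω * ‖E (Set.Icc 0 ω) f‖ ^ 2 := by
  obtain ⟨hproj, huniv, hinter, m, hm, hdom, hint⟩ := hE
  set B := Set.Icc 0 ω with hB
  have hBm : MeasurableSet B := measurableSet_Icc
  set u := E B f with hu
  have hidem : ∀ C, MeasurableSet C → E C u = E (C ∩ B) f := fun C hC => by
    rw [hinter C B hC hBm]; rfl
  have hmuniv : m u Set.univ = ENNReal.ofReal (‖u‖ ^ 2) := by
    rw [hm u _ MeasurableSet.univ, huniv, one_apply_eq_self, real_inner_self_eq_norm_sq]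
  have hfin : IsFiniteMeasure (m u) := ⟨by rw [hmuniv]; exact ENNReal.ofReal_lt_top⟩
  -- `E ∅ = 0` is not among the clauses, but holds since `m f` is a measure
  have hEempty : E ∅ f = 0 := by
    have h1 := hm f ∅ MeasurableSet.empty
    rw [measure_empty] at h1
    have h2 : E ∅ (E ∅ f) = E ∅ f :=
      congrArg (fun T : H →L[ℝ] H => T f) (hproj ∅ MeasurableSet.empty).isIdempotentElem
    have h3 : inner ℝ (E ∅ f) (E ∅ f) = inner ℝ (E ∅ f) f := by
      have hsym := ContinuousLinearMap.isSelfAdjoint_iff_isSymmetric.1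
        (hproj ∅ MeasurableSet.empty).isSelfAdjoint
      have := hsym (E ∅ f) f
      simp only [ContinuousLinearMap.coe_coe] at this
      rw [← this, h2]
    have h4 := ENNReal.ofReal_eq_zero.1 h1.symm
    rw [← h3, real_inner_self_eq_norm_sq] at h4
    simpa using le_antisymm h4 (sq_nonneg _)
  have hae : ∀ᵐ t ∂(m u), t ∈ B := by
    rw [ae_iff]
    change m u Bᶜ = 0
    rw [hm u _ hBm.compl, hidem _ hBm.compl, Set.compl_inter_self, hEempty]
    simp
  have hudom : u ∈ L.domain := by
    rw [hdom]
    calc ∫⁻ t, ENNReal.ofReal (t ^ 2) ∂(m u) ≤ ∫⁻ _, ENNReal.ofReal (ω ^ 2) ∂(m u) :=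
          lintegral_mono_ae (hae.mono fun t ht =>
            ENNReal.ofReal_le_ofReal (pow_le_pow_left₀ ht.1 ht.2 2))
      _ < ∞ := by
          rw [lintegral_const]
          exact ENNReal.mul_lt_top ENNReal.ofReal_lt_top (measure_lt_top _ _)
  refine ⟨L ⟨u, hudom⟩, L.mem_graph ⟨u, hudom⟩, ?_⟩
  rw [hint ⟨u, hudom⟩]
  have hintg : Integrable (fun t : ℝ => t) (m u) := by
    refine Integrable.of_bound measurable_id.aestronglyMeasurable ω (hae.mono fun t ht => ?_)
    rw [Real.norm_of_nonneg ht.1]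
    exact ht.2
  calc ∫ t, t ∂(m u) ≤ ∫ _, ω ∂(m u) :=
        integral_mono_ae hintg (integrable_const _) (hae.mono fun t ht => ht.2)
    _ = ω * ‖u‖ ^ 2 := by
        rw [integral_const, smul_eq_mul, measureReal_def, hmuniv,
          ENNReal.toReal_ofReal (sq_nonneg _), mul_comm]

lemma FormBound.finiteDimensional_paleyWiener {ε ω : ℝ} {n : ℕ} (h : FormBound L ε n) (hε : 0 ≤ ε)
    (hω : ε * ω < 1) (hE : ∃ E, IsSpectralMeasure L E) :
    FiniteDimensional ℝ (paleyWiener L ω) := by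
  have hE' : IsSpectralMeasure L (spectralMeasure L) := Classical.epsilon_spec hE
  refine (h.finrank_le hε hω (paleyWiener L ω).subtype (Submodule.injective_subtype _) ?_).1
  rintro ⟨_, f, rfl⟩
  exact hE'.exists_inner_le ω f

end PaleyWiener

/-! ### Discrete spectrum -/

section Enumeration

/-- A function with finite sublevel sets can be listed in increasing order, by an initial segment
of `ℕ`: break ties by an injection into `ℕ` and send a point to the number of its predecessors. -/
lemma exists_monotone_enumeration {ι : Type*} (lam : ι → ℝ) (h : ∀ ω, {i | lam i ≤ ω}.Finite) :
    ∃ J : Set ℕ, IsLowerSet J ∧ ∃ e : J ≃ ι, Monotone fun j => lam (e j) := by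
  have hc : Countable ι := by
    rw [← Set.countable_univ_iff]
    have : (Set.univ : Set ι) = ⋃ n : ℕ, {i | lam i ≤ n} := by
      ext i
      simpa using exists_nat_ge (lam i)
    rw [this]
    exact Set.countable_iUnion fun n => (h n).countable
  obtain ⟨c, hcinj⟩ := exists_injective_nat ι
  let κ : ι → ℝ ×ₗ ℕ := fun i => toLex (lam i, c i)
  have hκ : Function.Injective κ := fun i j hij =>
    hcinj (congrArg Prod.snd (toLex.injective hij))
  have hκlam : ∀ i j, κ i < κ j → lam i ≤ lam j := fun i j hij => by
    rcases Prod.Lex.lt_iff.1 hij with h1 | h1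
    · exact h1.le
    · exact h1.1.le
  have hlamκ : ∀ i j, lam i < lam j → κ i < κ j := fun i j hij =>
    Prod.Lex.lt_iff.2 (Or.inl hij)
  have hfin : ∀ i, {k | κ k < κ i}.Finite := fun i =>
    (h (lam i)).subset fun k hk => hκlam k i hk
  let rank : ι → ℕ := fun i => {k | κ k < κ i}.ncard
  have hrank : ∀ i j, κ i < κ j → rank i < rank j := fun i j hij =>
    Set.ncard_lt_ncard ⟨fun k hk => lt_trans hk hij, fun hsub => lt_irrefl (κ i) (hsub hij)⟩ (hfin j)
  have hinj : Function.Injective rank := fun i j hij => by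
    rcases lt_trichotomy (κ i) (κ j) with h1 | h1 | h1
    · exact absurd hij (hrank i j h1).ne
    · exact hκ h1
    · exact absurd hij (hrank j i h1).ne'
  have hpred : ∀ n, n + 1 ∈ Set.range rank → n ∈ Set.range rank := by
    rintro n ⟨i, hi⟩
    have hne : {k | κ k < κ i}.Nonempty := by
      apply Set.nonempty_of_ncard_ne_zero
      change rank i ≠ 0
      omega
    obtain ⟨k, hk, hmax⟩ := Set.exists_max_image _ κ (hfin i) hne
    refine ⟨k, ?_⟩
    have hins : {l | κ l < κ i} = insert k {l | κ l < κ k} := by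
      ext l
      constructor
      · intro hl
        rcases (hmax l hl).lt_or_eq with h1 | h1
        · exact Or.inr h1
        · exact Or.inl (hκ h1)
      · rintro (rfl | hl)
        · exact hk
        · exact lt_trans (show κ l < κ k from hl) hk
    have h2 : rank i = rank k + 1 := by
      change Set.ncard _ = Set.ncard _ + 1
      have hnot : k ∉ {l | κ l < κ k} := fun h => lt_irrefl (κ k) h
      rw [hins, Set.ncard_insert_of_notMem hnot (hfin k)]
    omega
  refine ⟨Set.range rank, fun a b hba ha => ?_, (Equiv.ofInjective rank hinj).symm, ?_⟩
  · exact Nat.decreasingInduction (motive := fun m _ => m ∈ Set.range rank)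
      (fun n _ => hpred n) ha hba
  · rintro ⟨_, i, rfl⟩ ⟨_, j, rfl⟩ hij
    have h1 : rank i ≤ rank j := hij
    change lam ((Equiv.ofInjective rank hinj).symm (Equiv.ofInjective rank hinj i)) ≤
      lam ((Equiv.ofInjective rank hinj).symm (Equiv.ofInjective rank hinj j))
    rw [Equiv.symm_apply_apply, Equiv.symm_apply_apply]
    by_contra hlt
    exact absurd (hrank j i (hlamκ j i (not_le.1 hlt))) h1.not_gt

end Enumeration

section DiscreteSpectrum

variable {H : Type*} [NormedAddCommGroup H] [InnerProductSpace ℝ H] [CompleteSpace H]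
  {L : H →ₗ.[ℝ] H}

lemma exists_isSpectralMeasure (hL : IsNonnegSelfAdjoint L) (hF : ∀ ε > 0, ∃ n, FormBound L ε n) :
    ∃ E, IsSpectralMeasure L E := by
  obtain ⟨R, hR⟩ := hL.exists_isResolvent
  obtain ⟨ι, b, lam, hb⟩ := hR.exists_eigenbasis hL (hR.isCompactOperator hL hF)
  exact ⟨_, isSpectralMeasure_eigenProjection hb hL⟩

lemma finiteDimensional_paleyWiener (hL : IsNonnegSelfAdjoint L)
    (hF : ∀ ε > 0, ∃ n, FormBound L ε n) (ω : ℝ) : FiniteDimensional ℝ (paleyWiener L ω) := by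
  obtain ⟨n, hn⟩ := hF (|ω| + 1)⁻¹ (by positivity)
  refine hn.finiteDimensional_paleyWiener (by positivity) ?_ (exists_isSpectralMeasure hL hF)
  rw [inv_mul_lt_one₀ (by positivity)]
  linarith [le_abs_self ω]

/-- Form bounds with arbitrarily small `ε` give a discrete spectrum and an orthonormal basis of
eigenvectors, listed with increasing eigenvalues. -/
lemma exists_ordered_eigenbasis (hL : IsNonnegSelfAdjoint L)
    (hF : ∀ ε > 0, ∃ n, FormBound L ε n) :
    ∃ J : Set ℕ, IsLowerSet J ∧
      ∃ (eig : J → ℝ) (ψ : HilbertBasis J ℝ H),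
        (∀ j, 0 ≤ eig j) ∧ Monotone eig ∧ Tendsto eig cofinite atTop ∧
        opSpectrum L = Set.range eig ∧ ∀ j, (ψ j, eig j • ψ j) ∈ L.graph := by
  obtain ⟨R, hR⟩ := hL.exists_isResolvent
  have hc := hR.isCompactOperator hL hF
  obtain ⟨ι, b, lam, hb⟩ := hR.exists_eigenbasis hL hc
  have hfin : ∀ ω, {i | lam i ≤ ω}.Finite := fun ω => by
    -- any `ε > 0` with `ε * ω < 1` will do
    obtain ⟨n, hn⟩ := hF (|ω| + 1)⁻¹ (by positivity)
    refine hn.finite_setOf_eigenvalue_le (by positivity) ?_ b.orthonormal hb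
    rw [inv_mul_lt_one₀ (by positivity)]
    linarith [le_abs_self ω]
  obtain ⟨J, hJ, e, he⟩ := exists_monotone_enumeration lam hfin
  have hrange : Set.range (fun j => b (e j)) = Set.range b := e.surjective.range_comp b
  let ψ : HilbertBasis J ℝ H := HilbertBasis.mk (v := fun j => b (e j))
    (b.orthonormal.comp e e.injective) (by rw [hrange, b.dense_span])
  have hψ : ∀ j, ψ j = b (e j) := fun j => congrFun (HilbertBasis.coe_mk _ _) j
  have hgraph : ∀ j, (ψ j, lam (e j) • ψ j) ∈ L.graph := fun j => by
    rw [hψ]; exact hb (e j)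
  refine ⟨J, hJ, fun j => lam (e j), ψ, fun j => eigenvalue_nonneg hb hL (e j), he, ?_,
    opSpectrum_eq_range hgraph hL hR hc, hgraph⟩
  refine tendsto_atTop.2 fun ω => ?_
  refine ((hfin ω).preimage e.injective.injOn).subset fun j hj => ?_
  have hj' : ¬ ω ≤ lam (e j) := hj
  exact (not_le.1 hj').le

end DiscreteSpectrum

/-! ### Metric lattices in doubling spaces -/

section Lattices

variable {X : Type*} [MetricSpace X]

lemma finite_of_pairwise_le_dist [CompactSpace X] {r : ℝ} (hr : 0 < r) {P : Set X}
    (hP : P.Pairwise fun p q => r ≤ dist p q) : P.Finite := by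
  obtain ⟨t, -, ht, hcov⟩ := finite_cover_balls_of_compact (isCompact_univ (X := X)) (half_pos hr)
  have hex : ∀ p : X, ∃ c ∈ t, dist p c < r / 2 := fun p => by
    have := hcov (Set.mem_univ p)
    simpa using this
  choose F hFt hF using hex
  refine Set.Finite.of_injOn (f := F) (fun p _ => hFt p) (fun p hp q hq hpq => ?_) ht
  by_contra hne
  have h1 := hP hp hq hne
  have h2 := dist_triangle_right p q (F p)
  have h3 := hF p
  have h4 := hF q
  rw [← hpq] at h4
  linarith

lemma exists_maximal_pairwise_le_dist (r : ℝ) :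
    ∃ P : Set X, P.Pairwise (fun p q => r ≤ dist p q) ∧ ∀ x, x ∉ P → ∃ p ∈ P, dist x p < r := by
  obtain ⟨P, hP⟩ := zorn_subset {P : Set X | P.Pairwise fun p q => r ≤ dist p q}
    fun c hc hchain => ⟨⋃₀ c, (Set.pairwise_sUnion hchain.directedOn).2 fun s hs => hc hs,
      fun s hs => Set.subset_sUnion_of_mem hs⟩
  refine ⟨P, hP.prop, fun x hx => ?_⟩
  by_contra! hfar
  have hins : (insert x P).Pairwise fun p q => r ≤ dist p q :=
    hP.prop.insert fun p hp _ => ⟨hfar p hp, by rw [dist_comm]; exact hfar p hp⟩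
  exact hx (hP.le_of_ge hins (Set.subset_insert x P) (Set.mem_insert x P))

variable [MeasurableSpace X] {μ : Measure X}

lemma IsDoublingMeasure.isUnifLocDoublingMeasure (hA : IsDoublingMeasure μ) :
    IsUnifLocDoublingMeasure μ := by
  obtain ⟨D, -, hD⟩ := hA
  refine ⟨⟨Real.toNNReal (2 ^ D) ^ 2, ?_⟩⟩
  filter_upwards [self_mem_nhdsWithin] with ε hε x
  have hε : 0 < ε := hε
  calc μ (closedBall x (2 * ε)) ≤ μ (ball x (2 * (2 * ε))) :=
        measure_mono (closedBall_subset_ball (by linarith))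
    _ ≤ ENNReal.ofReal (2 ^ D) * μ (ball x (2 * ε)) := (hD x _ (by positivity)).2
    _ ≤ ENNReal.ofReal (2 ^ D) * (ENNReal.ofReal (2 ^ D) * μ (ball x ε)) := by
        gcongr; exact (hD x _ hε).2
    _ ≤ ENNReal.ofReal (2 ^ D) * (ENNReal.ofReal (2 ^ D) * μ (closedBall x ε)) := by
        gcongr; exact ball_subset_closedBall
    _ = ↑(Real.toNNReal (2 ^ D) ^ 2) * μ (closedBall x ε) := by
        rw [← mul_assoc, sq]; rfl

variable [BorelSpace X]

/-- A maximal `ρ`-separated set is a lattice. Its multiplicity is bounded in terms of the doubling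
constant, since the balls of radius `ρ / 2` about its points at distance less than `ρ` from `x` are
disjoint, lie in `B(x, 2 ρ)` and have measure at least a fixed fraction of `|B(x, 2 ρ)|`. -/
lemma IsDoublingMeasure.exists_lattice [CompactSpace X] [IsFiniteMeasure μ]
    (hA : IsDoublingMeasure μ) :
    ∃ N : ℕ, ∀ ρ : ℝ, 0 < ρ → ∃ P : Set X, P.Finite ∧ IsMetricLattice ρ N P := by
  obtain ⟨D, -, hD⟩ := hA
  have hK : (0 : ℝ) < 2 ^ D := Real.rpow_pos_of_pos two_pos D
  set K : ℝ≥0∞ := ENNReal.ofReal (2 ^ D) with hKdef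
  refine ⟨⌈((2 : ℝ) ^ D) ^ 3⌉₊, fun ρ hρ => ?_⟩
  obtain ⟨P, hsep, hmax⟩ := exists_maximal_pairwise_le_dist (X := X) ρ
  have hPfin := finite_of_pairwise_le_dist hρ hsep
  have hdisj : P.PairwiseDisjoint fun p => ball p (ρ / 2) := fun p hp q hq hpq =>
    ball_disjoint_ball (by linarith [hsep hp hq hpq])
  refine ⟨P, hPfin, hdisj, ?_, fun x => ?_⟩
  · refine Set.eq_univ_of_forall fun x => ?_
    by_cases hx : x ∈ P
    · exact Set.mem_biUnion hx (mem_ball_self hρ)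
    · obtain ⟨p, hp, hxp⟩ := hmax x hx
      exact Set.mem_biUnion hp hxp
  · set Q := {p ∈ P | x ∈ ball p ρ} with hQ
    have hQfin : Q.Finite := hPfin.subset fun p hp => hp.1
    have hball : ∀ p ∈ Q, μ (ball x (2 * ρ)) ≤ K ^ 3 * μ (ball p (ρ / 2)) := fun p hp => by
      have hxp : dist x p < ρ := hp.2
      calc μ (ball x (2 * ρ)) ≤ μ (ball p (2 * (2 * (2 * (ρ / 2))))) := by
            refine measure_mono (ball_subset_ball' ?_)
            linarith
        _ ≤ K * μ (ball p (2 * (2 * (ρ / 2)))) := (hD p _ (by positivity)).2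
        _ ≤ K * (K * μ (ball p (2 * (ρ / 2)))) := by gcongr; exact (hD p _ (by positivity)).2
        _ ≤ K * (K * (K * μ (ball p (ρ / 2)))) := by gcongr; exact (hD p _ (by positivity)).2
        _ = K ^ 3 * μ (ball p (ρ / 2)) := by ring
    have hsum : ∑ p ∈ hQfin.toFinset, μ (ball p (ρ / 2)) ≤ μ (ball x (2 * ρ)) := by
      rw [← measure_biUnion_finset]
      · refine measure_mono (Set.iUnion₂_subset fun p hp => ball_subset_ball' ?_)
        have hxp : dist x p < ρ := ((hQfin.mem_toFinset).1 hp).2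
        rw [dist_comm]
        linarith
      · intro p hp q hq hpq
        exact hdisj ((hQfin.mem_toFinset).1 hp).1 ((hQfin.mem_toFinset).1 hq).1 hpq
      · exact fun p _ => measurableSet_ball
    have hcard : (hQfin.toFinset.card : ℝ≥0∞) * μ (ball x (2 * ρ)) ≤
        K ^ 3 * μ (ball x (2 * ρ)) := by
      calc (hQfin.toFinset.card : ℝ≥0∞) * μ (ball x (2 * ρ))
          = ∑ p ∈ hQfin.toFinset, μ (ball x (2 * ρ)) := by simp
        _ ≤ ∑ p ∈ hQfin.toFinset, K ^ 3 * μ (ball p (ρ / 2)) :=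
            Finset.sum_le_sum fun p hp => hball p ((hQfin.mem_toFinset).1 hp)
        _ = K ^ 3 * ∑ p ∈ hQfin.toFinset, μ (ball p (ρ / 2)) := by rw [Finset.mul_sum]
        _ ≤ _ := by gcongr
    have hle : (hQfin.toFinset.card : ℝ≥0∞) ≤ K ^ 3 :=
      (ENNReal.mul_le_mul_iff_left (hD x ρ hρ).1.ne' (measure_ne_top _ _)).1 hcard
    rw [hQfin.encard_eq_coe_toFinset_card]
    have hle' : (hQfin.toFinset.card : ℝ) ≤ (2 ^ D) ^ 3 := by
      rw [hKdef, ← ENNReal.ofReal_pow hK.le, ← ENNReal.ofReal_natCast] at hle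
      exact (ENNReal.ofReal_le_ofReal_iff (by positivity)).1 hle
    exact_mod_cast hle'.trans (Nat.le_ceil _)

/-- The passage from open balls to the closed balls used in Lebesgue differentiation. -/
lemma setIntegral_closedBall_nonneg {g : X → ℝ} (hg : Integrable g μ) {ρ₀ : ℝ}
    (h : ∀ (x : X) (ρ : ℝ), 0 < ρ → ρ < ρ₀ → 0 ≤ ∫ y in ball x ρ, g y ∂μ)
    (x : X) {ρ : ℝ} (hρ : 0 < ρ) (hρ₀ : ρ < ρ₀) : 0 ≤ ∫ y in closedBall x ρ, g y ∂μ := by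
  let r : ℕ → ℝ := fun n => ρ + (ρ₀ - ρ) / (n + 2)
  have hd : 0 < ρ₀ - ρ := sub_pos.2 hρ₀
  have hr : ∀ n, ρ < r n := fun n => by
    have : 0 < (ρ₀ - ρ) / ((n : ℝ) + 2) := by positivity
    simp only [r]; linarith
  have hr₀ : ∀ n, r n < ρ₀ := fun n => by
    have : (ρ₀ - ρ) / ((n : ℝ) + 2) < ρ₀ - ρ := by
      apply div_lt_self hd
      have : (0 : ℝ) ≤ n := n.cast_nonneg
      linarith
    simp only [r]; linarith
  have hrlim : Tendsto r atTop (𝓝 ρ) := by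
    have h1 : Tendsto (fun n : ℕ => (ρ₀ - ρ) / ((n : ℝ) + 2)) atTop (𝓝 0) :=
      tendsto_const_nhds.div_atTop
        (tendsto_atTop_add_const_right _ _ tendsto_natCast_atTop_atTop)
    simpa using tendsto_const_nhds.add h1
  have hinter : ⋂ n, ball x (r n) = closedBall x ρ := by
    ext y
    rw [Set.mem_iInter, mem_closedBall]
    exact ⟨fun hy => ge_of_tendsto' hrlim fun n => (mem_ball.1 (hy n)).le,
      fun hy n => mem_ball.2 (hy.trans_lt (hr n))⟩
  have hlim := tendsto_setIntegral_of_antitone (μ := μ) (f := g) (s := fun n => ball x (r n))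
    (fun n => measurableSet_ball) (fun m n hmn => ball_subset_ball (by simp only [r]; gcongr))
    ⟨0, hg.integrableOn⟩
  rw [hinter] at hlim
  exact ge_of_tendsto' hlim fun n => h x _ (hρ.trans (hr n)) (hr₀ n)

/-- By Lebesgue differentiation, a function whose integrals over all small balls are non-negative is
non-negative almost everywhere. -/
lemma IsDoublingMeasure.ae_nonneg [CompactSpace X] [IsFiniteMeasure μ] (hA : IsDoublingMeasure μ)
    {g : X → ℝ} (hg : Integrable g μ) {ρ₀ : ℝ} (hρ₀ : 0 < ρ₀)
    (h : ∀ (x : X) (ρ : ℝ), 0 < ρ → ρ < ρ₀ → 0 ≤ ∫ y in ball x ρ, g y ∂μ) : 0 ≤ᵐ[μ] g := by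
  have := hA.isUnifLocDoublingMeasure
  filter_upwards [IsUnifLocDoublingMeasure.ae_tendsto_average μ hg.locallyIntegrable 1] with x hx
  have hδpos : ∀ n : ℕ, 0 < ρ₀ / ((n : ℝ) + 2) := fun n => by positivity
  have hδ : Tendsto (fun n : ℕ => ρ₀ / ((n : ℝ) + 2)) atTop (𝓝[>] 0) :=
    tendsto_nhdsWithin_iff.2 ⟨tendsto_const_nhds.div_atTop
      (tendsto_atTop_add_const_right _ _ tendsto_natCast_atTop_atTop),
      Eventually.of_forall hδpos⟩
  refine ge_of_tendsto' (hx (fun _ => x) _ hδ (Eventually.of_forall fun n =>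
    mem_closedBall_self (by have := hδpos n; positivity))) fun n => ?_
  rw [setAverage_eq]
  refine smul_nonneg (by positivity) (setIntegral_closedBall_nonneg hg h x (hδpos n) ?_)
  apply div_lt_self hρ₀
  have : (0 : ℝ) ≤ n := n.cast_nonneg
  linarith

lemma IsMetricLattice.integral_le_sum {ρ : ℝ} {N : ℕ} {P : Finset X}
    (hP : IsMetricLattice ρ N (P : Set X)) {h : X → ℝ} (hi : Integrable h μ) (h0 : 0 ≤ᵐ[μ] h) :
    ∫ x, h x ∂μ ≤ ∑ p ∈ P, ∫ x in ball p ρ, h x ∂μ := by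
  simp_rw [← integral_indicator measurableSet_ball]
  rw [← integral_finsetSum _ fun p _ => hi.indicator measurableSet_ball]
  refine integral_mono_ae hi (integrable_finsetSum _ fun p _ => hi.indicator measurableSet_ball) ?_
  filter_upwards [h0] with x hx
  have hx' : 0 ≤ h x := hx
  have hmem : x ∈ ⋃ p ∈ (P : Set X), ball p ρ := hP.cover ▸ Set.mem_univ x
  simp only [Set.mem_iUnion] at hmem
  obtain ⟨p, hp, hxp⟩ := hmem
  calc h x = (ball p ρ).indicator h x := (Set.indicator_of_mem hxp h).symm
    _ ≤ _ := Finset.single_le_sum (f := fun p => (ball p ρ).indicator h x)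
      (fun q _ => Set.indicator_apply_nonneg fun _ => hx') hp

lemma IsMetricLattice.sum_integral_le {ρ : ℝ} {N : ℕ} {P : Finset X}
    (hP : IsMetricLattice ρ N (P : Set X)) {h : X → ℝ} (hi : Integrable h μ) (h0 : 0 ≤ᵐ[μ] h) :
    ∑ p ∈ P, ∫ x in ball p ρ, h x ∂μ ≤ N * ∫ x, h x ∂μ := by
  classical
  simp_rw [← integral_indicator measurableSet_ball]
  rw [← integral_finsetSum _ fun p _ => hi.indicator measurableSet_ball, ← integral_const_mul]
  refine integral_mono_ae (integrable_finsetSum _ fun p _ => hi.indicator measurableSet_ball)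
    (hi.const_mul _) ?_
  filter_upwards [h0] with x hx
  have hx' : 0 ≤ h x := hx
  have hcard : (P.filter fun p => x ∈ ball p ρ).card ≤ N := by
    have h1 := hP.multiplicity x
    have h2 : {p ∈ (P : Set X) | x ∈ ball p ρ} = ↑(P.filter fun p => x ∈ ball p ρ) := by
      ext p; simp
    rw [h2, Set.encard_coe_eq_coe_finsetCard] at h1
    exact_mod_cast h1
  have hsum : ∑ p ∈ P, (ball p ρ).indicator h x =
      (P.filter fun p => x ∈ ball p ρ).card * h x := by
    simp only [Set.indicator_apply]
    rw [← Finset.sum_filter, Finset.sum_const, nsmul_eq_mul]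
  change ∑ p ∈ P, (ball p ρ).indicator h x ≤ N * h x
  rw [hsum]
  gcongr

end Lattices

/-! ### The form bound of a lattice -/

section Poincare

variable {X : Type*} [MetricSpace X] [CompactSpace X] [MeasurableSpace X] [BorelSpace X]
  {μ : Measure X} [IsFiniteMeasure μ]

lemma ContinuousMap.integrable_of_compactSpace (f : C(X, ℝ)) : Integrable f μ :=
  Integrable.of_bound f.continuous.aestronglyMeasurable ‖f‖
    (Eventually.of_forall f.norm_coe_le_norm)

lemma coeFn_toL2 (f : C(X, ℝ)) : toL2 μ f =ᵐ[μ] f := ContinuousMap.coeFn_toLp μ f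

lemma norm_toL2_sq (f : C(X, ℝ)) : ‖toL2 μ f‖ ^ 2 = ∫ x, f x ^ 2 ∂μ := by
  rw [← real_inner_self_eq_norm_sq, toL2, ContinuousMap.inner_toLp]
  simp [sq]

lemma integrable_carreDuChamp (L : Lp ℝ 2 μ →ₗ.[ℝ] Lp ℝ 2 μ) (f g : C(X, ℝ)) :
    Integrable (carreDuChamp L f g) μ := by
  have hL : ∀ u : Lp ℝ 2 μ, Integrable u μ := fun u => (Lp.memLp u).integrable (by norm_num)
  have hmul : ∀ (f : C(X, ℝ)) (u : Lp ℝ 2 μ), Integrable (fun x => f x * u x) μ := fun f u =>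
    (hL u).bdd_mul f.continuous.aestronglyMeasurable (Eventually.of_forall f.norm_coe_le_norm)
  exact (((hmul f _).add (hmul g _)).sub (hL _)).div_const 2

/-- The variance of `f` over a set of positive measure. -/
lemma setIntegral_sub_average_sq (f : C(X, ℝ)) {s : Set X} (hs : μ s ≠ 0) :
    ∫ y in s, |f y - ⨍ z in s, f z ∂μ| ^ 2 ∂μ =
      ∫ y in s, f y ^ 2 ∂μ - (∫ y in s, f y ∂μ) ^ 2 / μ.real s := by
  have hpos : 0 < μ.real s := ENNReal.toReal_pos hs (measure_ne_top _ _)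
  set a := ⨍ z in s, f z ∂μ with ha
  have ha' : a * μ.real s = ∫ y in s, f y ∂μ := by
    rw [ha, setAverage_eq, smul_eq_mul]
    field_simp
  have hf : IntegrableOn (fun y => f y) s μ := f.integrable_of_compactSpace.integrableOn
  have hf2 : IntegrableOn (fun y => f y ^ 2) s μ :=
    (f ^ 2).integrable_of_compactSpace.integrableOn
  have h1 : ∀ y, |f y - a| ^ 2 = f y ^ 2 - 2 * a * f y + a ^ 2 := fun y => by
    rw [sq_abs]; ring
  have hsub : IntegrableOn (fun y => f y ^ 2 - 2 * a * f y) s μ := hf2.sub (hf.const_mul _)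
  simp_rw [h1]
  rw [integral_add hsub (integrable_const _),
    integral_sub hf2 (hf.const_mul _), integral_const_mul, integral_const, ← ha']
  simp only [measureReal_restrict_apply_univ, smul_eq_mul]
  field_simp
  ring

/-- The normalized indicator of a ball, as a vector of `L₂(X, μ)`. -/
noncomputable def ballVector (μ : Measure X) [IsFiniteMeasure μ] (p : X) (ρ : ℝ) : Lp ℝ 2 μ :=
  (√(μ.real (ball p ρ)))⁻¹ •
    indicatorConstLp 2 measurableSet_ball (measure_ne_top μ (ball p ρ)) (1 : ℝ)

lemma inner_ballVector_toL2_sq (f : C(X, ℝ)) (p : X) (ρ : ℝ) :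
    inner ℝ (ballVector μ p ρ) (toL2 μ f) ^ 2 =
      (∫ y in ball p ρ, f y ∂μ) ^ 2 / μ.real (ball p ρ) := by
  rw [ballVector, inner_smul_left, L2.inner_indicatorConstLp_one,
    setIntegral_congr_ae (g := f) measurableSet_ball ((coeFn_toL2 f).mono fun x hx _ => hx),
    mul_pow]
  simp only [conj_trivial, inv_pow]
  rw [Real.sq_sqrt measureReal_nonneg]
  ring

variable {L : Lp ℝ 2 μ →ₗ.[ℝ] Lp ℝ 2 μ}

/-- The Poincaré inequalities on the balls of a lattice add up to a form bound, with one functional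
per ball. They hold on `D^∞(L)`, and pass to `D(L)` since `D^∞(L)` is a core. -/
lemma exists_formBound_of_lattice (hA : IsDoublingMeasure μ) (hL : IsNonnegSelfAdjoint L)
    (hB : SmoothDomainIsSubalgebra L) (hC : GradientBound L) (hD : LocalPoincare L) :
    ∃ K : ℝ, 0 < K ∧ ∃ ρ₀ : ℝ, 0 < ρ₀ ∧ ∀ (ρ : ℝ) (N : ℕ) (P : Set X), 0 < ρ → ρ < ρ₀ →
      P.Finite → IsMetricLattice ρ N P → FormBound L (K * N * ρ ^ 2) P.ncard := by
  obtain ⟨A, hA'⟩ := hB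
  obtain ⟨c, hc, hgrad⟩ := hC
  obtain ⟨C, hC, ρ₀, hρ₀, hpoinc⟩ := hD
  have hpos : ∀ (p : X) {ρ : ℝ}, 0 < ρ → μ (ball p ρ) ≠ 0 := fun p ρ hρ => by
    obtain ⟨D, -, hD⟩ := hA
    have := (hD p (ρ / 2) (half_pos hρ)).1
    rw [mul_div_cancel₀ ρ two_ne_zero] at this
    exact this.ne'
  refine ⟨C * c, by positivity, ρ₀, hρ₀, fun ρ N P hρ hρ' hPfin hP => ?_⟩
  obtain ⟨F, rfl⟩ := hPfin.exists_finset_coe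
  have hsmooth : ∀ f : C(X, ℝ), toL2 μ f ∈ smoothDomain L → ∀ g, (toL2 μ f, g) ∈ L.graph →
      ‖toL2 μ f‖ ^ 2 ≤ ∑ p ∈ F, inner ℝ (ballVector μ p ρ) (toL2 μ f) ^ 2 +
        C * c * N * ρ ^ 2 * inner ℝ g (toL2 μ f) := by
    intro f hf g hg
    have hΓ := integrable_carreDuChamp L f f
    have hΓ0 : 0 ≤ᵐ[μ] carreDuChamp L f f := by
      refine hA.ae_nonneg hΓ hρ₀ fun x r hr hr' => ?_
      have h1 := hpoinc f hf x r hr hr'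
      have h2 : 0 ≤ ∫ y in ball x r, |f y - ⨍ z in ball x r, f z ∂μ| ^ 2 ∂μ :=
        integral_nonneg fun y => by positivity
      exact nonneg_of_mul_nonneg_right (h2.trans h1) (by positivity)
    have hball : ∀ p, ∫ y in ball p ρ, f y ^ 2 ∂μ ≤ inner ℝ (ballVector μ p ρ) (toL2 μ f) ^ 2 +
        C * ρ ^ 2 * ∫ y in ball p ρ, carreDuChamp L f f y ∂μ := fun p => by
      have h1 := hpoinc f hf p ρ hρ hρ'
      rw [setIntegral_sub_average_sq f (hpos p hρ), ← inner_ballVector_toL2_sq] at h1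
      linarith
    have hgr := hgrad f hf
    rw [hL.norm_opSqrt_sq hg] at hgr
    calc ‖toL2 μ f‖ ^ 2 = ∫ x, f x ^ 2 ∂μ := norm_toL2_sq f
      _ ≤ ∑ p ∈ F, ∫ y in ball p ρ, f y ^ 2 ∂μ :=
          hP.integral_le_sum (h := fun x => f x ^ 2) (f ^ 2).integrable_of_compactSpace
            (Eventually.of_forall fun x => sq_nonneg (f x))
      _ ≤ ∑ p ∈ F, (inner ℝ (ballVector μ p ρ) (toL2 μ f) ^ 2 +
            C * ρ ^ 2 * ∫ y in ball p ρ, carreDuChamp L f f y ∂μ) :=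
          Finset.sum_le_sum fun p _ => hball p
      _ = ∑ p ∈ F, inner ℝ (ballVector μ p ρ) (toL2 μ f) ^ 2 +
            C * ρ ^ 2 * ∑ p ∈ F, ∫ y in ball p ρ, carreDuChamp L f f y ∂μ := by
          rw [Finset.sum_add_distrib, Finset.mul_sum]
      _ ≤ ∑ p ∈ F, inner ℝ (ballVector μ p ρ) (toL2 μ f) ^ 2 +
            C * ρ ^ 2 * (N * (c * inner ℝ g (toL2 μ f))) := by
          gcongr
          exact (hP.sum_integral_le hΓ hΓ0).trans (by gcongr)
      _ = _ := by ring
  have hall : ∀ f g : Lp ℝ 2 μ, (f, g) ∈ L.graph → ‖f‖ ^ 2 ≤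
      ∑ p ∈ F, inner ℝ (ballVector μ p ρ) f ^ 2 + C * c * N * ρ ^ 2 * inner ℝ g f := by
    intro f g hfg
    obtain ⟨R, hR⟩ := hL.exists_isResolvent
    choose f' g' hf' hg' hfε hgε using fun n : ℕ =>
      hR.exists_smoothDomain_approx hL hfg (Nat.one_div_pos_of_nat (α := ℝ) (n := n))
    have hflim : Tendsto f' atTop (𝓝 f) := by
      rw [tendsto_iff_norm_sub_tendsto_zero]
      refine squeeze_zero (fun _ => norm_nonneg _) (fun n => ?_)
        tendsto_one_div_add_atTop_nhds_zero_nat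
      rw [norm_sub_rev]; exact hfε n
    have hglim : Tendsto g' atTop (𝓝 g) := by
      rw [tendsto_iff_norm_sub_tendsto_zero]
      refine squeeze_zero (fun _ => norm_nonneg _) (fun n => ?_)
        tendsto_one_div_add_atTop_nhds_zero_nat
      rw [norm_sub_rev]; exact hgε n
    refine le_of_tendsto_of_tendsto' (hflim.norm.pow 2)
      ((tendsto_finsetSum F fun p _ => (tendsto_const_nhds.inner hflim).pow 2).add
        ((hglim.inner hflim).const_mul _)) fun n => ?_
    have hmem := hf' n
    rw [← SetLike.mem_coe, ← hA'] at hmem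
    obtain ⟨h, -, hh⟩ := hmem
    have h1 := hsmooth h (by rw [hh]; exact hf' n) (g' n) (by rw [hh]; exact hg' n)
    rwa [hh] at h1
  rw [Set.ncard_coe_finset]
  refine ⟨fun i => ballVector μ (F.equivFin.symm i) ρ, fun f g hfg => ?_⟩
  rw [Equiv.sum_comp F.equivFin.symm fun p : F => inner ℝ (ballVector μ p ρ) f ^ 2,
    Finset.sum_coe_sort F fun p => inner ℝ (ballVector μ p ρ) f ^ 2]
  exact hall f g hfg

end Poincare

/-! ### Eigenvalue counting by lattices -/

theorem theorem4p3 {X : Type*} [MetricSpace X] [CompactSpace X] [MeasurableSpace X] [BorelSpace X]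
    (μ : Measure X) [IsFiniteMeasure μ] (hA : IsDoublingMeasure μ)
    (L : Lp ℝ 2 μ →ₗ.[ℝ] Lp ℝ 2 μ) (hL : IsNonnegSelfAdjoint L)
    (hB : SmoothDomainIsSubalgebra L) (hC : GradientBound L) (hD : LocalPoincare L) :
    -- every Paley–Wiener space is finite-dimensional
    (∀ ω : ℝ, 0 < ω → FiniteDimensional ℝ (paleyWiener L ω)) ∧
    -- discrete spectrum `0 ≤ λ₀ ≤ λ₁ ≤ …` tending to infinity, orthonormal eigenbasis
    -- (`J` is `ℕ`, or an initial segment of it if `L₂` is finite-dimensional)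
    (∃ J : Set ℕ, IsLowerSet J ∧
      ∃ (eig : J → ℝ) (ψ : HilbertBasis J ℝ (Lp ℝ 2 μ)),
        (∀ j, 0 ≤ eig j) ∧ Monotone eig ∧ Tendsto eig cofinite atTop ∧
        opSpectrum L = Set.range eig ∧ ∀ j, (ψ j, eig j • ψ j) ∈ L.graph) ∧
    -- there is a multiplicity bound for which lattices of every small mesh exist
    (∃ N : ℕ, ∀ᶠ ρ in 𝓝[>] (0 : ℝ), ∃ P : Set X, IsMetricLattice ρ N P) ∧
    -- the counting estimate
    (∀ N : ℕ, ∃ γ : ℝ, 0 < γ ∧ γ < 1 ∧ ∀ᶠ ω : ℝ in atTop,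
      eigenvalueCount L ω ≤
        ⨅ (P : Set X) (_ : IsMetricLattice (γ * ω ^ (-(1 / 2) : ℝ)) N P), P.encard) := by
  obtain ⟨K, hK, ρ₀, hρ₀, hbound⟩ := exists_formBound_of_lattice hA hL hB hC hD
  obtain ⟨N₀, hN₀⟩ := hA.exists_lattice
  have hF : ∀ ε > 0, ∃ n, FormBound L ε n := fun ε hε => by
    have hlim : Tendsto (fun ρ : ℝ => K * N₀ * ρ ^ 2) (𝓝[>] 0) (𝓝 0) := by
      have : Tendsto (fun ρ : ℝ => K * N₀ * ρ ^ 2) (𝓝 0) (𝓝 (K * N₀ * 0 ^ 2)) :=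
        (continuous_const.mul (continuous_pow 2)).tendsto 0
      rw [zero_pow two_ne_zero, mul_zero] at this
      exact this.mono_left nhdsWithin_le_nhds
    obtain ⟨ρ, h1, h2⟩ :=
      ((hlim.eventually (gt_mem_nhds hε)).and (Ioo_mem_nhdsGT hρ₀)).exists
    obtain ⟨P, hPfin, hP⟩ := hN₀ ρ h2.1
    exact ⟨_, (hbound ρ N₀ P h2.1 h2.2 hPfin hP).mono hL h1.le⟩
  refine ⟨fun ω _ => finiteDimensional_paleyWiener hL hF ω, exists_ordered_eigenbasis hL hF,
    ⟨N₀, ?_⟩, fun N => ?_⟩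
  · filter_upwards [self_mem_nhdsWithin] with ρ hρ
    obtain ⟨P, -, hP⟩ := hN₀ ρ hρ
    exact ⟨P, hP⟩
  · have hKN : 0 ≤ K * N := by positivity
    -- this choice gives `K * N * γ ^ 2 < 1`
    set γ : ℝ := (2 + K * N)⁻¹ with hγ
    have hγ0 : 0 < γ := by positivity
    have hγ1 : γ < 1 := inv_lt_one_of_one_lt₀ (by linarith)
    have hγ2 : K * N * γ ^ 2 < 1 := by
      have h1 : K * N * γ < 1 := by
        rw [hγ, ← div_eq_mul_inv, div_lt_one (by positivity)]
        linarith
      nlinarith [mul_nonneg hKN hγ0.le]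
    refine ⟨γ, hγ0, hγ1, ?_⟩
    have hlim : Tendsto (fun ω : ℝ => γ * ω ^ (-(1 / 2) : ℝ)) atTop (𝓝 0) := by
      simpa using (tendsto_rpow_neg_atTop (y := 1 / 2) (by norm_num)).const_mul γ
    filter_upwards [eventually_gt_atTop 0, hlim.eventually (gt_mem_nhds hρ₀)] with ω hω hω'
    refine le_iInf₂ fun P hP => ?_
    by_cases hPfin : P.Finite
    · have hsq : (γ * ω ^ (-(1 / 2) : ℝ)) ^ 2 * ω = γ ^ 2 := by
        rw [mul_pow, ← Real.rpow_natCast (ω ^ (-(1 / 2) : ℝ)), ← Real.rpow_mul hω.le, mul_assoc]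
        norm_num
        rw [Real.rpow_neg_one, inv_mul_cancel₀ hω.ne', mul_one]
      rw [← hPfin.cast_ncard_eq]
      refine (hbound _ N P (by positivity) hω' hPfin hP).eigenvalueCount_le hL (by positivity) ?_
      rw [mul_assoc, hsq]
      exact hγ2
    · rw [Set.Infinite.encard_eq hPfin]
      exact le_top
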